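/- For $d\ge 1$ let $\Phi^M_{\mathbb Q}(d)$ be the set of isomorphism classes of the groups $E(K)_{tors}$, where $E: y^2=x^3+c$ with $c\in\mathbb Q$, $c\ne 0$, and $K$ is a number field of degree $d$ over $\mathbb Q$. Then $$\Phi^M_{\mathbb Q}(6)=\Phi^M_{\mathbb Q}(3)\cup\{\mathbb Z/9\oplus\mathbb Z/3,\ \mathbb Z/6\oplus\mathbb Z/6,\ \mathbb Z/6\oplus\mathbb Z/2,\ \mathbb Z/3\oplus\mathbb Z/3,\ \mathbb Z/2\oplus\mathbb Z/2\}.$$ Moreover, let $c$ be a sixth-power-free integer (an integer not divisible by the sixth power of any non-unit; in particular $c\neq 0$), let $K$ be a number field of degree $6$, and let $T$ be the torsion subgroup of $E(K)$ for $E: y^2=x^3+c$. Write $\omega$ for a primitive cube root of unity, and write $\mathbb Q(r)\subset K$ if $K$ contains a root $r$ of $X^3-3X^2+1$. Then $T$ is isomorphic to: 1. $\mathbb Z/9$, if $c$ is a square and $4c$ is a cube in $K$, $\omega\notin K$ and $\mathbb Q(r)\subset K$; 2. $\mathbb Z/6$, if $c$ is both a square and a cube in $K$ and $\omega\notin K$;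 or if $c$ and $4$ are cubes in $K$, $-3c$ is a square in $K$ and $\omega\notin K$; 3. $\mathbb Z/3$, if $c$ is a square but not a cube in $K$ and $4c$ is not a cube in $K$; or if $c$ is a square but not a cube in $K$, $4c$ is a cube in $K$, $\omega\notin K$ and $\mathbb Q(r)\not\subset K$; or if $c$ is not a cube in $K$, $4c$ is a cube and $-3c$ is a square in $K$ and $\omega\notin K$; 4. $\mathbb Z/2$, if $c$ is a cube but not a square in $K$, $\omega\notin K$, and $4$ is not a cube in $K$ or $-3c$ is not a square in $K$; 5. $\mathbb Z/9\oplus\mathbb Z/3$, if $c$ is a square and $4c$ is a cube in $K$, $\omega\in K$ and $\mathbb Q(r)\subset K$; 6. $\mathbb Z/6\oplus\mathbb Z/6$, if $c$ is both a square and a cube in $K$, $4$ is a cube in $K$ and $\omega\in K$; 7. $\mathbb Z/6\oplus\mathbb Z/2$, if $c$ is both a square and a cube in $K$, $4$ is not a cube in $K$ and $\omega\in K$; 8. $\mathbb Z/3\oplus\mathbb Z/3$, if $c$ is a square but not a cube in $K$, $4c$ is a cube in $K$, $\omega\in K$ and $\mathbb Q(r)\not\subset K$; 9. $\mathbb Z/2\oplus\mathbb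 Z/2$, if $c$ is a cube but not a square in $K$ and $\omega\in K$; 10. the trivial group, otherwise. -/

import Mathlib

/-- The Mordell curve `y² = x³ + c`, as a Weierstrass curve. -/
def mordellCurve {K : Type*} [Field K] (c : K) : WeierstrassCurve K where
  a₁ := 0
  a₂ := 0
  a₃ := 0
  a₄ := 0
  a₆ := c

open Classical in
/-- The torsion subgroup `E(K)_tors` of the group of `K`-rational points of `E : y² = x³ + c`. -/
noncomputable def mordellTorsion (K : Type*) [Field K] (c : K) :
    AddSubgroup (mordellCurve c).toAffine.Point :=
  AddCommGroup.torsion (mordellCurve c).toAffine.Point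

open Classical in
/-- `E(K)_tors` is isomorphic to the group `G`, where `E : y² = x³ + c`. -/
def MordellTorsionIso (K : Type*) [Field K] (c : K) (G : Type*) [AddCommGroup G] : Prop :=
  Nonempty (mordellTorsion K c ≃+ G)

/-- The isomorphism class of an abelian group. -/
def isoClass (G : Type*) [AddCommGroup G] : Set AddCommGrpCat.{0} :=
  {H | Nonempty (H ≃+ G)}

/-- The set `Φ^M_ℚ(d)`: all abelian groups that are isomorphic to `E(K)_tors` for some Mordell
curve `E : y² = x³ + c` over `ℚ` (so `c ≠ 0`) and some number field `K` of degree `d`. It is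
closed under isomorphism, that is, a union of isomorphism classes. -/
def PhiMQ (d : ℕ) : Set AddCommGrpCat.{0} :=
  {H | ∃ c : ℚ, c ≠ 0 ∧ ∃ (K : Type) (_ : Field K) (_ : NumberField K),
    Module.finrank ℚ K = d ∧ MordellTorsionIso K (c : K) H}

/-- `c` is sixth-power-free: no sixth power of a non-unit divides it. In particular `c ≠ 0`. -/
def SixthPowerFree (c : ℤ) : Prop :=
  ∀ n : ℤ, n ^ 6 ∣ c → IsUnit n

/-- `a` is a cube in `K`. -/
def IsCube {K : Type*} [Field K] (a : K) : Prop :=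
  ∃ b : K, b ^ 3 = a

/-- `ω ∈ K`: the field `K` contains a primitive cube root of unity. -/
def HasOmega (K : Type*) [Field K] : Prop :=
  ∃ ω : K, IsPrimitiveRoot ω 3

/-- `ℚ(r) ⊂ K` for a root `r` of `X³ - 3X² + 1`. -/
def HasR (K : Type*) [Field K] : Prop :=
  ∃ r : K, r ^ 3 - 3 * r ^ 2 + 1 = 0

/-- The condition for `ℤ/9`. -/
def Cond9 (K : Type*) [Field K] (c : K) : Prop :=
  IsSquare c ∧ IsCube (4 * c) ∧ ¬ HasOmega K ∧ HasR K

/-- The condition for `ℤ/6`. -/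
def Cond6 (K : Type*) [Field K] (c : K) : Prop :=
  (IsSquare c ∧ IsCube c ∧ ¬ HasOmega K) ∨
  (IsCube c ∧ IsCube (4 : K) ∧ IsSquare (-3 * c) ∧ ¬ HasOmega K)

/-- The condition for `ℤ/3`. -/
def Cond3 (K : Type*) [Field K] (c : K) : Prop :=
  (IsSquare c ∧ ¬ IsCube c ∧ ¬ IsCube (4 * c)) ∨
  (IsSquare c ∧ ¬ IsCube c ∧ IsCube (4 * c) ∧ ¬ HasOmega K ∧ ¬ HasR K) ∨
  (¬ IsCube c ∧ IsCube (4 * c) ∧ IsSquare (-3 * c) ∧ ¬ HasOmega K)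

/-- The condition for `ℤ/2`. -/
def Cond2 (K : Type*) [Field K] (c : K) : Prop :=
  (IsCube c ∧ ¬ IsSquare c ∧ ¬ IsCube (4 : K) ∧ ¬ HasOmega K) ∨
  (IsCube c ∧ ¬ IsSquare c ∧ ¬ IsSquare (-3 * c) ∧ ¬ HasOmega K)

/-- The condition for `ℤ/9 ⊕ ℤ/3`. -/
def Cond93 (K : Type*) [Field K] (c : K) : Prop :=
  IsSquare c ∧ IsCube (4 * c) ∧ HasOmega K ∧ HasR K

/-- The condition for `ℤ/6 ⊕ ℤ/6`. -/
def Cond66 (K : Type*) [Field K] (c : K) : Prop :=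
  IsSquare c ∧ IsCube c ∧ IsCube (4 : K) ∧ HasOmega K

/-- The condition for `ℤ/6 ⊕ ℤ/2`. -/
def Cond62 (K : Type*) [Field K] (c : K) : Prop :=
  IsSquare c ∧ IsCube c ∧ ¬ IsCube (4 : K) ∧ HasOmega K

/-- The condition for `ℤ/3 ⊕ ℤ/3`. -/
def Cond33 (K : Type*) [Field K] (c : K) : Prop :=
  IsSquare c ∧ ¬ IsCube c ∧ IsCube (4 * c) ∧ HasOmega K ∧ ¬ HasR K

/-- The condition for `ℤ/2 ⊕ ℤ/2`. -/
def Cond22 (K : Type*) [Field K] (c : K) : Prop :=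
  IsCube c ∧ ¬ IsSquare c ∧ HasOmega K

/-! Everything rests on one bound: over a field of degree 3 or 6, 18 kills the torsion
(`nsmul_eighteen_eq_zero`). Primes p ≡ 2 mod 3 of good reduction are supersingular for y² = x³ + c.
For q an odd power of p, cubing permutes F_q, so the reduced curve has q + 1 points over F_q. Over
F_{q²}, the q-power Frobenius splits twice a point into a part it fixes and a part it negates, each
lying in a group of order q + 1. Some prime of K above p has residue degree 1, 2, 3 or 6, so 2(p³ +
1) kills a given torsion point for all large p ≡ 2 mod 3. Dirichlet's theorem and a finer look at
points of order 4 then leave only 18.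

So the torsion is E[2] ⊕ E[9] over K, and both factors can be written down. The 2-torsion is given
by the cube roots of -c, the 3-torsion by (0, √c) and (∛(-4c), √(-3c)). By the tripling formula, a
point of order 9 above x = 0 requires that c is a square, that 4c is a cube and that X³ - 3X² + 1
has a root r; these conditions also suffice. A point of order 9 above another 3-torsion point would
require a root of w³ + 3rw² + 1. Since 9 does not divide [K : ℚ], such a root would already give one
in ℚ(r), where a descent at 19, which splits completely there, rules it out. The same descent shows
that 2 is not a cube in K when r ∈ K, so points of order 9 and of order 2 never coexist.

For Φ, the five cyclic groups occur both over ℚ(r) and over ℚ(r, i), and the five others over ℚ(r,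
√-3), ℚ(∛2, √-3) and ℚ(∛3, √-3). A cubic field does not contain ω, so only cyclic groups occur
there. -/

/-- `P` is the affine point `(x, y)`. -/
def IsPt {K : Type*} [Field K] {c : K} (P : (mordellCurve c).toAffine.Point) (x y : K) : Prop :=
  ∃ h, P = .some x y h

/-! ### Coordinates and the group law on y² = x³ + c. -/

section Points

variable {K : Type*} [Field K] {c : K}

theorem mordell_nonsingular_iff (h6 : (6 : K) ≠ 0) (hc : c ≠ 0) (x y : K) :
    (mordellCurve c).toAffine.Nonsingular x y ↔ y ^ 2 = x ^ 3 + c := by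
  have h2 : (2 : K) ≠ 0 := fun h => h6 (by linear_combination 3 * h)
  have h3 : (3 : K) ≠ 0 := fun h => h6 (by linear_combination 2 * h)
  rw [WeierstrassCurve.Affine.nonsingular_iff, WeierstrassCurve.Affine.equation_iff]
  simp only [mordellCurve, zero_mul, add_zero]
  refine ⟨fun h => h.1, fun h => ⟨h, ?_⟩⟩
  by_contra! hh
  obtain ⟨hx, hy⟩ := hh
  have hx0 : x = 0 := by simpa [h3] using hx.symm
  have hy0 : y = 0 := by
    have : 2 * y = 0 := by linear_combination hy
    simpa [h2] using this
  apply hc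
  subst hx0 hy0
  linear_combination -h

theorem IsPt.eqn {P : (mordellCurve c).toAffine.Point} {x y : K} (h : IsPt P x y) :
    y ^ 2 = x ^ 3 + c := by
  obtain ⟨h, -⟩ := h
  have := h.1
  rw [WeierstrassCurve.Affine.equation_iff] at this
  simpa [mordellCurve] using this

theorem exists_isPt (h6 : (6 : K) ≠ 0) (hc : c ≠ 0) {x y : K} (h : y ^ 2 = x ^ 3 + c) :
    ∃ P : (mordellCurve c).toAffine.Point, IsPt P x y :=
  ⟨.some x y ((mordell_nonsingular_iff h6 hc x y).2 h), _, rfl⟩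

theorem eq_zero_or_isPt (P : (mordellCurve c).toAffine.Point) :
    P = 0 ∨ ∃ x y, IsPt P x y := by
  rcases P with _ | ⟨x, y, h⟩
  · exact .inl rfl
  · exact .inr ⟨x, y, h, rfl⟩

theorem IsPt.ne_zero {P : (mordellCurve c).toAffine.Point} {x y : K} (h : IsPt P x y) :
    P ≠ 0 := by
  obtain ⟨h, rfl⟩ := h
  exact WeierstrassCurve.Affine.Point.some_ne_zero h

theorem IsPt.inj {P : (mordellCurve c).toAffine.Point} {x y x' y' : K} (h : IsPt P x y)
    (h' : IsPt P x' y') : x = x' ∧ y = y' := by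
  obtain ⟨h, rfl⟩ := h
  obtain ⟨h', e⟩ := h'
  simpa using e

theorem IsPt.eq {P Q : (mordellCurve c).toAffine.Point} {x y : K} (h : IsPt P x y)
    (h' : IsPt Q x y) : P = Q := by
  obtain ⟨h, rfl⟩ := h
  obtain ⟨h', rfl⟩ := h'
  rfl

theorem IsPt.neg {P : (mordellCurve c).toAffine.Point} {x y : K} (h : IsPt P x y) :
    IsPt (-P) x (-y) := by
  obtain ⟨h, rfl⟩ := h
  rw [WeierstrassCurve.Affine.Point.neg_some]
  have e : (mordellCurve c).toAffine.negY x y = -y := by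
    simp [WeierstrassCurve.Affine.negY, mordellCurve]
  generalize_proofs hh
  revert hh
  rw [e]
  exact fun hh => ⟨hh, rfl⟩

theorem IsPt.eq_or_eq_neg {P Q : (mordellCurve c).toAffine.Point} {x y y' : K} (h : IsPt P x y)
    (h' : IsPt Q x y') : P = Q ∨ P = -Q := by
  have e : (y - y') * (y + y') = 0 := by linear_combination h.eqn - h'.eqn
  rcases mul_eq_zero.1 e with e | e
  · obtain rfl : y = y' := by linear_combination e
    exact .inl (h.eq h')
  · obtain rfl : y = -y' := by linear_combination e
    exact .inr (h.eq h'.neg)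

variable [DecidableEq K]

/-- The slope enters through an equation, not a quotient, so that one element of a ring can serve as
slope both upstairs and in a residue field. -/
theorem IsPt.add {P Q : (mordellCurve c).toAffine.Point} {x y x' y' l : K} (h : IsPt P x y)
    (h' : IsPt Q x' y') (hx : x ≠ x') (hl : l * (x - x') = y - y') :
    IsPt (P + Q) (l ^ 2 - x - x') (-(l * (l ^ 2 - x - x' - x) + y)) := by
  obtain ⟨h, rfl⟩ := h
  obtain ⟨h', rfl⟩ := h'
  rw [WeierstrassCurve.Affine.Point.add_of_X_ne hx]
  have hx' : x - x' ≠ 0 := sub_ne_zero.2 hx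
  have e : (mordellCurve c).toAffine.slope x x' y y' = l := by
    rw [WeierstrassCurve.Affine.slope_of_X_ne hx, div_eq_iff hx', hl]
  generalize_proofs hh
  revert hh
  rw [e]
  simp only [WeierstrassCurve.Affine.addX, WeierstrassCurve.Affine.addY,
    WeierstrassCurve.Affine.negAddY, WeierstrassCurve.Affine.negY, mordellCurve, zero_mul,
    sub_zero, add_zero]
  exact fun hh => ⟨hh, rfl⟩

theorem IsPt.double {P : (mordellCurve c).toAffine.Point} {x y l : K} (h : IsPt P x y)
    (h2 : (2 : K) ≠ 0) (hy : y ≠ 0) (hl : l * (2 * y) = 3 * x ^ 2) :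
    IsPt (P + P) (l ^ 2 - x - x) (-(l * (l ^ 2 - x - x - x) + y)) := by
  obtain ⟨h, rfl⟩ := h
  have hy' : y ≠ (mordellCurve c).toAffine.negY x y := by
    simp only [WeierstrassCurve.Affine.negY, mordellCurve, zero_mul, sub_zero]
    intro e
    exact mul_ne_zero h2 hy (by linear_combination e)
  rw [WeierstrassCurve.Affine.Point.add_self_of_Y_ne hy']
  have e : (mordellCurve c).toAffine.slope x x y y = l := by
    rw [WeierstrassCurve.Affine.slope_of_Y_ne rfl hy']
    simp only [WeierstrassCurve.Affine.negY, mordellCurve, zero_mul, sub_zero, mul_zero, add_zero]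
    rw [div_eq_iff (by rw [sub_neg_eq_add, ← two_mul]; exact mul_ne_zero h2 hy)]
    linear_combination -hl
  generalize_proofs hh
  revert hh
  rw [e]
  simp only [WeierstrassCurve.Affine.addX, WeierstrassCurve.Affine.addY,
    WeierstrassCurve.Affine.negAddY, WeierstrassCurve.Affine.negY, mordellCurve, zero_mul,
    sub_zero, add_zero]
  exact fun hh => ⟨hh, rfl⟩

end Points

/-! ### Reduction of points along a pair of ring maps A → K and A → k. -/

section Reduction

variable {A K k : Type*} [CommRing A] [Field K] [Field k] {c : K} {d : k}

/-- `P'` is the image of `P` under the partially defined map `φ ∘ i⁻¹` on coordinates. -/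
def Reduces (i : A →+* K) (φ : A →+* k) (P : (mordellCurve c).toAffine.Point)
    (P' : (mordellCurve d).toAffine.Point) : Prop :=
  (P = 0 ∧ P' = 0) ∨ ∃ a b, IsPt P (i a) (i b) ∧ IsPt P' (φ a) (φ b)

variable {i : A →+* K} {φ : A →+* k}

theorem Reduces.eq_zero_iff {P : (mordellCurve c).toAffine.Point}
    {P' : (mordellCurve d).toAffine.Point} (h : Reduces i φ P P') : P = 0 ↔ P' = 0 := by
  rcases h with ⟨rfl, rfl⟩ | ⟨a, b, h, h'⟩
  · simp
  · simp [h.ne_zero, h'.ne_zero]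

theorem Reduces.unique (hi : Function.Injective i) {P : (mordellCurve c).toAffine.Point}
    {P' P'' : (mordellCurve d).toAffine.Point} (h : Reduces i φ P P') (h' : Reduces i φ P P'') :
    P' = P'' := by
  rcases h with ⟨rfl, rfl⟩ | ⟨a, b, h1, h2⟩
  · exact (h'.eq_zero_iff.1 rfl).symm
  · rcases h' with ⟨rfl, rfl⟩ | ⟨a', b', h1', h2'⟩
    · exact absurd rfl h1.ne_zero
    · obtain ⟨ha, hb⟩ := h1.inj h1'
      obtain rfl := hi ha
      obtain rfl := hi hb
      exact h2.eq h2'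

/-- The two hypotheses make the slope denominators units of `A`. The slope then lies in `A`, and the
addition formula can be mapped to `K` and to `k` alike. -/
theorem Reduces.add [DecidableEq K] [DecidableEq k] (hi : Function.Injective i)
    (hk2 : (2 : k) ≠ 0)
    {P Q : (mordellCurve c).toAffine.Point} {P' Q' : (mordellCurve d).toAffine.Point}
    (hP : Reduces i φ P P') (hQ : Reduces i φ Q Q')
    (hx : ∀ a b a' b', IsPt P (i a) (i b) → IsPt Q (i a') (i b') → a ≠ a' → IsUnit (a - a'))
    (hy : ∀ a b, IsPt Q (i a) (i b) → b ≠ 0 → IsUnit (2 * b)) :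
    Reduces i φ (P + Q) (P' + Q') := by
  rcases hP with ⟨rfl, rfl⟩ | ⟨a, b, h1, h1'⟩
  · simpa using hQ
  rcases hQ with ⟨rfl, rfl⟩ | ⟨a', b', h2, h2'⟩
  · rw [add_zero, add_zero]
    exact .inr ⟨a, b, h1, h1'⟩
  have hK2 : (2 : K) ≠ 0 := by
    intro h
    apply hk2
    have : (2 : A) = 0 := hi (by rw [map_ofNat, map_zero, h])
    rw [← map_ofNat φ 2, this, map_zero]
  by_cases haa : a = a'
  · subst haa
    rcases h1.eq_or_eq_neg h2 with e | e
    · have hb : b = b' := by subst e; exact hi (h1.inj h2).2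
      subst hb
      obtain rfl := h1.eq h2
      obtain rfl := h1'.eq h2'
      by_cases hb : b = 0
      · subst hb
        refine .inl ⟨?_, ?_⟩
        · exact add_eq_zero_iff_eq_neg.2 (h1.eq (by simpa using h1.neg))
        · exact add_eq_zero_iff_eq_neg.2 (h1'.eq (by simpa using h1'.neg))
      · obtain ⟨u, hu⟩ := hy a b h1 hb
        have hu' : (↑u⁻¹ : A) * (2 * b) = 1 := by rw [← hu]; exact u.inv_mul
        have hib : i b ≠ 0 := fun h => hb (hi (by simpa using h))
        have hφb : φ b ≠ 0 := by
          intro h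
          have := congrArg φ hu'
          simp [h] at this
        have hl : (↑u⁻¹ * (3 * a ^ 2)) * (2 * b) = 3 * a ^ 2 := by
          linear_combination (3 * a ^ 2) * hu'
        have k1 := h1.double hK2 hib (l := i (↑u⁻¹ * (3 * a ^ 2)))
          (by simpa only [map_mul, map_ofNat, map_pow] using congrArg i hl)
        have k2 := h1'.double hk2 hφb (l := φ (↑u⁻¹ * (3 * a ^ 2)))
          (by simpa only [map_mul, map_ofNat, map_pow] using congrArg φ hl)
        generalize (↑u⁻¹ * (3 * a ^ 2)) = l at k1 k2
        exact .inr ⟨l ^ 2 - a - a, -(l * (l ^ 2 - a - a - a) + b), by simpa using k1,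
          by simpa using k2⟩
    · have hb : b = -b' := by subst e; exact hi (by simpa using (h1.inj h2.neg).2)
      subst hb
      refine .inl ⟨add_eq_zero_iff_eq_neg.2 e, add_eq_zero_iff_eq_neg.2 (h1'.eq ?_)⟩
      simpa using h2'.neg
  · obtain ⟨u, hu⟩ := hx a b a' b' h1 h2 haa
    have hu' : (↑u⁻¹ : A) * (a - a') = 1 := by rw [← hu]; exact u.inv_mul
    have hia : i a ≠ i a' := fun h => haa (hi h)
    have hφa : φ a ≠ φ a' := by
      intro h
      have := congrArg φ hu'
      simp [h] at this
    have hl : (↑u⁻¹ * (b - b')) * (a - a') = b - b' := by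
      linear_combination (b - b') * hu'
    have k1 := h1.add h2 hia (l := i (↑u⁻¹ * (b - b')))
      (by simpa only [map_mul, map_sub] using congrArg i hl)
    have k2 := h1'.add h2' hφa (l := φ (↑u⁻¹ * (b - b')))
      (by simpa only [map_mul, map_sub] using congrArg φ hl)
    generalize (↑u⁻¹ * (b - b')) = l at k1 k2
    exact .inr ⟨l ^ 2 - a - a', -(l * (l ^ 2 - a - a' - a) + b), by simpa using k1,
      by simpa using k2⟩

end Reduction

/-! ### Functoriality of points in the field. -/

section MapPoint

variable {K k : Type*} [Field K] [Field k] [DecidableEq K] [DecidableEq k] {c : K} {d : k}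

/-- The homomorphism on points induced by a homomorphism of fields. -/
noncomputable def mordellMap (σ : K →+* k) (hσ : σ c = d) (h6 : (6 : k) ≠ 0) (hd : d ≠ 0) :
    (mordellCurve c).toAffine.Point →+ (mordellCurve d).toAffine.Point :=
  have key : ∀ P : (mordellCurve c).toAffine.Point, ∃ P' : (mordellCurve d).toAffine.Point,
      Reduces (RingHom.id K) σ P P' := by
    intro P
    rcases eq_zero_or_isPt P with rfl | ⟨x, y, h⟩
    · exact ⟨0, .inl ⟨rfl, rfl⟩⟩
    · obtain ⟨P', h'⟩ := exists_isPt h6 hd (x := σ x) (y := σ y)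
        (by rw [← hσ, ← map_pow, ← map_pow, ← map_add, h.eqn])
      exact ⟨P', .inr ⟨x, y, h, h'⟩⟩
  have h2 : (2 : k) ≠ 0 := fun h => h6 (by linear_combination 3 * h)
  -- The image of P + Q and the sum of the images both reduce P + Q, so they agree by uniqueness. In
  -- a field every nonzero slope denominator is a unit.
  AddMonoidHom.mk' (fun P => (key P).choose) fun P Q =>
    Reduces.unique Function.injective_id (key (P + Q)).choose_spec
      (Reduces.add Function.injective_id h2 (key P).choose_spec (key Q).choose_spec
        (fun _ _ _ _ _ _ h => (sub_ne_zero.2 h).isUnit)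
        (fun _ _ _ h => (mul_ne_zero (fun h2' => h2 (by
          rw [← map_ofNat σ 2, h2', map_zero])) h).isUnit))

theorem reduces_mordellMap (σ : K →+* k) (hσ : σ c = d) (h6 : (6 : k) ≠ 0) (hd : d ≠ 0)
    (P : (mordellCurve c).toAffine.Point) :
    Reduces (RingHom.id K) σ P (mordellMap σ hσ h6 hd P) := by
  unfold mordellMap
  generalize_proofs h1 h2
  exact (h1 P).choose_spec

theorem IsPt.map (σ : K →+* k) (hσ : σ c = d) (h6 : (6 : k) ≠ 0) (hd : d ≠ 0)
    {P : (mordellCurve c).toAffine.Point} {x y : K} (h : IsPt P x y) :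
    IsPt (mordellMap σ hσ h6 hd P) (σ x) (σ y) := by
  rcases reduces_mordellMap σ hσ h6 hd P with ⟨rfl, -⟩ | ⟨a, b, h1, h2⟩
  · exact absurd rfl h.ne_zero
  · obtain ⟨rfl, rfl⟩ := h1.inj h
    exact h2

theorem mordellMap_injective (σ : K →+* k) (hσ : σ c = d) (h6 : (6 : k) ≠ 0) (hd : d ≠ 0) :
    Function.Injective (mordellMap σ hσ h6 hd) :=
  (injective_iff_map_eq_zero _).2 fun P h => (reduces_mordellMap σ hσ h6 hd P).eq_zero_iff.2 h

end MapPoint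

theorem AddSubgroup.nsmul_eq_zero_of_natCard_eq {G : Type*} [AddGroup G] (H : AddSubgroup G)
    {n : ℕ} (hn : Nat.card H = n) {x : G} (hx : x ∈ H) : n • x = 0 := by
  have : Nat.card H • (⟨x, hx⟩ : H) = 0 := card_nsmul_eq_zero'
  rw [hn] at this
  exact congrArg Subtype.val this

/-! ### Supersingular point counts over finite fields. -/

section FiniteField

open Polynomial in
theorem card_pow_eq_mul_le {k : Type*} [Field k] (e : k) {q : ℕ} (hq : 2 ≤ q) :
    Nat.card {y : k // y ^ q = e * y} ≤ q := by
  classical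
  have hdeg : (X ^ q - C e * X : k[X]).natDegree = q := by
    rw [natDegree_sub_eq_left_of_natDegree_lt, natDegree_X_pow]
    rw [natDegree_X_pow]
    exact ((natDegree_C_mul_le e X).trans natDegree_X_le).trans_lt (by omega)
  have hne : (X ^ q - C e * X : k[X]) ≠ 0 := by
    intro h
    rw [h, natDegree_zero] at hdeg
    omega
  have hsub : ∀ y : k, y ^ q = e * y ↔ y ∈ (X ^ q - C e * X : k[X]).roots.toFinset := by
    intro y
    simp [hne, sub_eq_zero]
  calc Nat.card {y : k // y ^ q = e * y}
      = Nat.card {y : k // y ∈ (X ^ q - C e * X : k[X]).roots.toFinset} :=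
        Nat.card_congr (Equiv.subtypeEquivRight hsub)
    _ = (X ^ q - C e * X : k[X]).roots.toFinset.card := by
        rw [Nat.card_eq_fintype_card, Fintype.card_coe]
    _ ≤ _ := Multiset.toFinset_card_le _
    _ ≤ _ := card_roots' _
    _ = q := hdeg

/-- The map z ↦ (z + σz, z - σz) embeds a set of q² elements in a product of two sets of at most q
elements each, so both bounds are attained. -/
theorem card_pow_eq_mul_eq {k : Type*} [Field k] [Finite k] (h2 : (2 : k) ≠ 0) {q : ℕ}
    (hq : 2 ≤ q) (σ : k →+* k) (hσ : ∀ x, σ x = x ^ q) (hk : Nat.card k = q ^ 2) :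
    Nat.card {y : k // y ^ q = 1 * y} = q ∧ Nat.card {y : k // y ^ q = -1 * y} = q := by
  have h1 := card_pow_eq_mul_le (1 : k) hq
  have h3 := card_pow_eq_mul_le (-1 : k) hq
  have hσσ : ∀ x, σ (σ x) = x := by
    intro x
    cases nonempty_fintype k
    rw [hσ, hσ, ← pow_mul, ← sq, ← hk, Nat.card_eq_fintype_card, FiniteField.pow_card]
  let f : k → {y : k // y ^ q = 1 * y} × {y : k // y ^ q = -1 * y} := fun z =>
    (⟨z + σ z, by rw [← hσ, map_add, hσσ]; ring⟩, ⟨z - σ z, by rw [← hσ, map_sub, hσσ]; ring⟩)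
  have hf : Function.Injective f := by
    intro z w h
    simp only [f, Prod.mk.injEq, Subtype.mk.injEq] at h
    exact mul_left_cancel₀ h2 (by linear_combination h.1 + h.2)
  have hle := Nat.card_le_card_of_injective f hf
  rw [Nat.card_prod, hk] at hle
  constructor <;> nlinarith

variable {k : Type*} [Field k]

/-- With q = 3j + 2 one has 3(2j + 1) = 2(q - 1) + 1, so x ↦ x^(2j+1) inverts cubing on the elements
fixed by the q-th power. -/
theorem pow_pow_of_pow_eq_self {a : k} {j : ℕ} (h : a ^ (3 * j + 2) = a) :
    a ^ (3 * (2 * j + 1)) = a :=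
  calc a ^ (3 * (2 * j + 1)) = a ^ (3 * j + 2) * a ^ (3 * j + 1) := by ring
    _ = a * a ^ (3 * j + 1) := by rw [h]
    _ = a ^ (3 * j + 2) := by ring
    _ = a := h

/-- As e² = 1, y² - c is fixed by σ, and x is its only fixed cube root. The points other than 0 thus
correspond to the q values of y. The sign e = 1 gives the points fixed by Frobenius, e = -1 those it
negates. -/
theorem natCard_of_mem_iff {c : k} (h6 : (6 : k) ≠ 0) (hc : c ≠ 0) {j : ℕ}
    (hcq : c ^ (3 * j + 2) = c) (σ : k →+* k) (hσ : ∀ x, σ x = x ^ (3 * j + 2)) [Finite k]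
    {e : k} (he : e ^ 2 = 1) (he' : Nat.card {y : k // y ^ (3 * j + 2) = e * y} = 3 * j + 2)
    (H : Set (mordellCurve c).toAffine.Point)
    (hH : ∀ P, P ∈ H ↔ P = 0 ∨ ∃ x y, IsPt P x y ∧ x ^ (3 * j + 2) = x ∧
      y ^ (3 * j + 2) = e * y) :
    Nat.card H = 3 * j + 3 := by
  have hfix : ∀ y : k, y ^ (3 * j + 2) = e * y → (y ^ 2 - c) ^ (3 * j + 2) = y ^ 2 - c := by
    intro y hy
    rw [← hσ, map_sub, map_pow, hσ, hσ, hy, hcq, mul_pow, he, one_mul]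
  have hex : ∀ y : {y : k // y ^ (3 * j + 2) = e * y}, ∃ P : H,
      IsPt P.1 ((y.1 ^ 2 - c) ^ (2 * j + 1)) y.1 := by
    rintro ⟨y, hy⟩
    obtain ⟨P, hP⟩ := exists_isPt h6 hc (x := (y ^ 2 - c) ^ (2 * j + 1)) (y := y) (by
      rw [← pow_mul, mul_comm, pow_pow_of_pow_eq_self (hfix y hy)]
      ring)
    refine ⟨⟨P, (hH P).2 (.inr ⟨_, _, hP, ?_, hy⟩)⟩, hP⟩
    rw [← pow_mul, mul_comm, pow_mul, hfix y hy]
  choose f hf using hex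
  let g : Option {y : k // y ^ (3 * j + 2) = e * y} → H := fun o =>
    o.elim ⟨0, (hH 0).2 (.inl rfl)⟩ f
  have hg : Function.Bijective g := by
    constructor
    · rintro (_ | y) (_ | z) h
      · rfl
      · exact absurd (congrArg Subtype.val h).symm (hf z).ne_zero
      · exact absurd (congrArg Subtype.val h) (hf y).ne_zero
      · have h' : f y = f z := h
        have h1 := hf y
        rw [h'] at h1
        rw [Subtype.ext (h1.inj (hf z)).2]
    · rintro ⟨P, hP⟩
      rcases (hH P).1 hP with rfl | ⟨x, y, h, hx, hy⟩
      · exact ⟨none, rfl⟩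
      · refine ⟨some ⟨y, hy⟩, Subtype.ext ?_⟩
        refine (hf ⟨y, hy⟩).eq ?_
        have : (y ^ 2 - c) ^ (2 * j + 1) = x := by
          rw [h.eqn, add_sub_cancel_right, ← pow_mul, pow_pow_of_pow_eq_self hx]
        simpa only [this] using h
  rw [← Nat.card_eq_of_bijective g hg, Finite.card_option, he']

variable [DecidableEq k]

theorem nsmul_eq_zero_of_card_eq [Finite k] {c : k} (h6 : (6 : k) ≠ 0) (hc : c ≠ 0) {q : ℕ}
    (hq : q % 3 = 2) (hk : Nat.card k = q) (P : (mordellCurve c).toAffine.Point) :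
    (q + 1) • P = 0 := by
  obtain ⟨j, rfl⟩ : ∃ j, q = 3 * j + 2 := ⟨q / 3, by omega⟩
  cases nonempty_fintype k
  have hpow : ∀ x : k, x ^ (3 * j + 2) = x := fun x => by
    rw [← hk, Nat.card_eq_fintype_card, FiniteField.pow_card]
  have := natCard_of_mem_iff h6 hc (hpow c) (RingHom.id k) (fun x => (hpow x).symm) (e := 1)
    (by simp) (by simp only [one_mul, hpow]; rw [← hk]; simp) Set.univ (fun P => by
      simpa [hpow] using eq_zero_or_isPt P)
  rw [Nat.card_univ] at this
  rw [← this]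
  exact card_nsmul_eq_zero'

/-- 2P is the sum of P + FP, fixed by Frobenius F, and P - FP, negated by it; both lie in groups of
order q + 1. If q ≡ 1 mod 4, then q + 1 ≡ 2 mod 4, so for 4P = 0 both parts are killed by 2. -/
theorem nsmul_eq_zero_of_card_eq_sq [Finite k] {c : k} (h6 : (6 : k) ≠ 0) (hc : c ≠ 0) {q : ℕ}
    (hq : q % 3 = 2) (σ : k →+* k) (hσ : ∀ x, σ x = x ^ q) (hcq : c ^ q = c)
    (hk : Nat.card k = q ^ 2) (P : (mordellCurve c).toAffine.Point) :
    (2 * (q + 1)) • P = 0 ∧ (q % 4 = 1 → 4 • P = 0 → 2 • P = 0) := by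
  obtain ⟨j, rfl⟩ : ∃ j, q = 3 * j + 2 := ⟨q / 3, by omega⟩
  have h2 : (2 : k) ≠ 0 := fun h => h6 (by linear_combination 3 * h)
  obtain ⟨c1, c2⟩ := card_pow_eq_mul_eq h2 (by omega) σ hσ hk
  have hσc : σ c = c := by rw [hσ, hcq]
  have hσσ : ∀ x, σ (σ x) = x := by
    intro x
    cases nonempty_fintype k
    rw [hσ, hσ, ← pow_mul, ← sq, ← hk, Nat.card_eq_fintype_card, FiniteField.pow_card]
  let F := mordellMap σ hσc h6 hc
  have hFpt : ∀ {P x y}, IsPt P x y → IsPt (F P) (σ x) (σ y) := fun h => h.map σ hσc h6 hc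
  have hFF : ∀ P, F (F P) = P := by
    intro P
    rcases eq_zero_or_isPt P with rfl | ⟨x, y, h⟩
    · simp
    · exact (hFpt (hFpt h)).eq (by rwa [hσσ, hσσ])
  have hm1 : ∀ P, P ∈ F.eqLocus (AddMonoidHom.id _) ↔ P = 0 ∨ ∃ x y, IsPt P x y ∧
      x ^ (3 * j + 2) = x ∧ y ^ (3 * j + 2) = 1 * y := by
    intro P
    change F P = P ↔ _
    constructor
    · intro h
      refine (eq_zero_or_isPt P).imp_right ?_
      rintro ⟨x, y, hxy⟩
      have := hFpt hxy
      rw [h] at this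
      obtain ⟨e1, e2⟩ := this.inj hxy
      exact ⟨x, y, hxy, by rw [← hσ, e1], by rw [← hσ, e2, one_mul]⟩
    · rintro (rfl | ⟨x, y, hxy, e1, e2⟩)
      · simp
      · refine (hFpt hxy).eq ?_
        rw [hσ, hσ, e1, e2, one_mul]
        exact hxy
  have hm2 : ∀ P, P ∈ F.eqLocus (-AddMonoidHom.id _) ↔ P = 0 ∨ ∃ x y, IsPt P x y ∧
      x ^ (3 * j + 2) = x ∧ y ^ (3 * j + 2) = -1 * y := by
    intro P
    change F P = -P ↔ _
    constructor
    · intro h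
      refine (eq_zero_or_isPt P).imp_right ?_
      rintro ⟨x, y, hxy⟩
      have := hFpt hxy
      rw [h] at this
      obtain ⟨e1, e2⟩ := this.inj hxy.neg
      exact ⟨x, y, hxy, by rw [← hσ, e1], by rw [← hσ, e2, neg_one_mul]⟩
    · rintro (rfl | ⟨x, y, hxy, e1, e2⟩)
      · simp
      · refine (hFpt hxy).eq ?_
        rw [hσ, hσ, e1, e2, neg_one_mul]
        exact hxy.neg
  have k1 := natCard_of_mem_iff h6 hc hcq σ hσ (by ring) c1 _ hm1
  have k2 := natCard_of_mem_iff h6 hc hcq σ hσ (by ring) c2 _ hm2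
  have n1 : ∀ Q, F Q = Q → (3 * j + 3) • Q = 0 := fun Q hQ =>
    AddSubgroup.nsmul_eq_zero_of_natCard_eq _ k1 hQ
  have n2 : ∀ Q, F Q = -Q → (3 * j + 3) • Q = 0 := fun Q hQ =>
    AddSubgroup.nsmul_eq_zero_of_natCard_eq _ k2 hQ
  have fA : F (P + F P) = P + F P := by rw [map_add, hFF, add_comm]
  have fB : F (P - F P) = -(P - F P) := by rw [map_sub, hFF, neg_sub]
  have nA := n1 _ fA
  have nB := n2 _ fB
  refine ⟨?_, fun hq4 h4 => ?_⟩
  · have : (2 * (3 * j + 2 + 1)) • P = (3 * j + 3) • (P + F P) + (3 * j + 3) • (P - F P) := by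
      rw [← nsmul_add, show P + F P + (P - F P) = 2 • P by rw [two_nsmul]; abel, ← mul_nsmul']
      congr 1; ring
    rw [this, nA, nB, add_zero]
  · have h4F : 4 • F P = 0 := by rw [← map_nsmul, h4, map_zero]
    have two_of : ∀ Q : (mordellCurve c).toAffine.Point, (3 * j + 3) • Q = 0 → 4 • Q = 0 → 2 • Q = 0 := by
      intro Q h1 h2
      obtain ⟨m, hm⟩ : ∃ m, 3 * j + 3 = 4 * m + 2 := ⟨(3 * j + 3) / 4, by omega⟩
      rwa [hm, add_nsmul, mul_comm 4, mul_nsmul', h2, nsmul_zero, zero_add] at h1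
    have A2 := two_of _ nA (by rw [nsmul_add, h4, h4F, add_zero])
    have B2 := two_of _ nB (by rw [nsmul_sub, h4, h4F, sub_zero])
    -- A point killed by 2 is its own negative, so both parts are now fixed by `F`.
    have fB' : F (P - F P) = P - F P := by
      rw [fB, neg_eq_iff_add_eq_zero, ← two_nsmul, B2]
    -- The fixed field contains only one cube root of -c, hence there is only one fixed point of
    -- order 2. Two nonzero parts must coincide, which gives 2FP = 0.
    have uniq : ∀ Q R : (mordellCurve c).toAffine.Point, F Q = Q → F R = R → 2 • Q = 0 → 2 • R = 0 → Q ≠ 0 → R ≠ 0 → Q = R := by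
      intro Q R hQ hR hQ2 hR2 hQ0 hR0
      obtain ⟨x, y, hxy, hx, -⟩ := ((hm1 Q).1 hQ).resolve_left hQ0
      obtain ⟨x', y', hxy', hx', -⟩ := ((hm1 R).1 hR).resolve_left hR0
      have z : ∀ {Q : (mordellCurve c).toAffine.Point} {x y}, IsPt Q x y → 2 • Q = 0 → y = 0 := by
        intro Q x y h hQ
        rw [two_nsmul, ← eq_neg_iff_add_eq_zero] at hQ
        have h' := h.neg
        rw [← hQ] at h'
        have := (h.inj h').2
        exact mul_left_cancel₀ h2 (by linear_combination this)
      obtain rfl := z hxy hQ2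
      obtain rfl := z hxy' hR2
      have e : x ^ 3 = x' ^ 3 := by linear_combination hxy'.eqn - hxy.eqn
      have : x = x' := by
        rw [← pow_pow_of_pow_eq_self hx, ← pow_pow_of_pow_eq_self hx', pow_mul, pow_mul, e]
      subst this
      exact hxy.eq hxy'
    by_cases hA : P + F P = 0
    · exact two_of _ (n2 P (by rw [← neg_eq_of_add_eq_zero_right hA])) h4
    by_cases hB : P - F P = 0
    · exact two_of _ (n1 P (sub_eq_zero.1 hB).symm) h4
    have := uniq _ _ fA fB' A2 B2 hA hB
    have hF2 : 2 • F P = 0 := by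
      rw [two_nsmul]
      have h : P + F P - (P - F P) = 0 := by rw [this, sub_self]
      rwa [add_sub_sub_cancel] at h
    rw [← map_nsmul] at hF2
    exact (map_eq_zero_iff _ (mordellMap_injective σ hσc h6 hc)).1 hF2

end FiniteField

/-! ### Good reduction of a torsion point of a number field. -/

section NumberFieldReduction

open NumberField

/-- In Σ e·f = 3 or 6, suppose every f is at least 4 and none is 6. Two primes would contribute at
least 8, and so would one with e ≥ 2. A single prime with e = 1 has f = 3 or 6, a contradiction. -/
theorem exists_prime_over_natCard {K : Type*} [Field K] [NumberField K]
    (hK : Module.finrank ℚ K = 3 ∨ Module.finrank ℚ K = 6) {p : ℕ} (hp : p.Prime) :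
    ∃ Q : Ideal (𝓞 K), Q.IsMaximal ∧ (p : 𝓞 K) ∈ Q ∧
      ∃ f, (f = 1 ∨ f = 2 ∨ f = 3 ∨ f = 6) ∧ Nat.card (𝓞 K ⧸ Q) = p ^ f := by
  classical
  have := Fact.mk hp
  let I : Ideal ℤ := Ideal.span {(p : ℤ)}
  have hpZ : Prime (p : ℤ) := Nat.prime_iff_prime_int.1 hp
  have hI : I.IsMaximal :=
    PrincipalIdealRing.isMaximal_of_irreducible hpZ.irreducible
  have hIp : I.IsPrime := hI.isPrime
  have hI0 : I ≠ ⊥ := by simpa [I] using hp.ne_zero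
  let : Fintype (I.primesOver (𝓞 K)) := (Algebra.QuasiFinite.finite_primesOver I).fintype
  have hsum := Ideal.sum_ramification_inertia_eq_finrank I (𝓞 K)
  rw [RingOfIntegers.rank] at hsum
  have hpos : ∀ q : I.primesOver (𝓞 K), 0 < q.1.ramificationIdx ℤ := fun q =>
    have := q.2.1
    Ideal.ramificationIdx_pos q.1 ℤ
  suffices h : ∃ q : I.primesOver (𝓞 K), q.1.inertiaDeg ℤ = 1 ∨ q.1.inertiaDeg ℤ = 2 ∨
      q.1.inertiaDeg ℤ = 3 ∨ q.1.inertiaDeg ℤ = 6 by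
    obtain ⟨⟨Q, hQ, hQI⟩, hf⟩ := h
    have hQm : Q.IsMaximal := Ideal.IsMaximal.of_liesOver_isMaximal Q I
    refine ⟨Q, hQm, ?_, _, hf, ?_⟩
    · have : (p : ℤ) ∈ Q.under ℤ := by
        rw [← Ideal.over_def Q I]
        exact Ideal.mem_span_singleton_self _
      simpa using this
    · change Nat.card (𝓞 K ⧸ Q) = p ^ Ideal.inertiaDeg Q ℤ
      rw [Ideal.inertiaDeg_eq_of_isMaximal I Q]
      let := Ideal.Quotient.field I
      have hc : Nat.card (ℤ ⧸ I) = p := by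
        rw [Nat.card_congr (Int.quotientSpanNatEquivZMod p).toEquiv, Nat.card_zmod]
      have : Finite (ℤ ⧸ I) := Nat.finite_of_card_ne_zero (by rw [hc]; exact hp.ne_zero)
      rw [Module.natCard_eq_pow_finrank (K := ℤ ⧸ I), hc]
  by_contra! hcon
  obtain ⟨q⟩ : Nonempty (I.primesOver (𝓞 K)) := inferInstance
  have hfpos : ∀ q : I.primesOver (𝓞 K), 0 < q.1.inertiaDeg ℤ := fun q =>
    have := q.2.1
    Ideal.inertiaDeg_pos q.1 ℤ
  have hf4 : ∀ q : I.primesOver (𝓞 K), 4 ≤ q.1.inertiaDeg ℤ := fun q => by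
    have := hfpos q
    have := hcon q
    omega
  have hle : ∀ q : I.primesOver (𝓞 K), 4 ≤ q.1.ramificationIdx ℤ * q.1.inertiaDeg ℤ := fun q => by
    have := hf4 q
    have := hpos q
    nlinarith
  rw [← Finset.add_sum_erase _ _ (Finset.mem_univ q)] at hsum
  rcases (Finset.univ.erase q).eq_empty_or_nonempty with h | ⟨q', hq'⟩
  · rw [h, Finset.sum_empty, add_zero] at hsum
    have h4 := hf4 q
    have h1 := hcon q
    have h0 := hpos q
    generalize q.1.inertiaDeg ℤ = f at *
    generalize q.1.ramificationIdx ℤ = e at *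
    have he : e = 1 := by
      by_contra he
      have : 2 ≤ e := by omega
      have : 8 ≤ e * f := by nlinarith
      omega
    subst he
    omega
  · have h1 := Finset.single_le_sum (f := fun q : I.primesOver (𝓞 K) =>
      q.1.ramificationIdx ℤ * q.1.inertiaDeg ℤ) (fun _ _ => Nat.zero_le _) hq'
    have h2 := hle q
    have h3 := hle q'
    omega

variable {K : Type*} [Field K] [NumberField K] [DecidableEq K]

/-- A torsion point has finitely many multiples, so only finitely many elements must be integral at
Q: the coordinates, c and its inverse, and the inverse slope denominators. Large p achieves this,
and the localization at Q maps both to K and to the residue field. The relation v·d = u records that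
d lies in the prime field. -/
theorem exists_good_reduction {c : ℚ} (hc : c ≠ 0) {P : (mordellCurve (c : K)).toAffine.Point}
    (hP : IsOfFinAddOrder P) :
    ∃ N : ℕ, ∀ p : ℕ, p.Prime → N < p → ∀ (Q : Ideal (𝓞 K)) [Q.IsMaximal], (p : 𝓞 K) ∈ Q →
      letI := Ideal.Quotient.field Q
      letI : DecidableEq (𝓞 K ⧸ Q) := Classical.decEq _
      (6 : 𝓞 K ⧸ Q) ≠ 0 ∧ ∃ d : 𝓞 K ⧸ Q, d ≠ 0 ∧
        (∃ u v : ℤ, (v : 𝓞 K ⧸ Q) ≠ 0 ∧ v * d = u) ∧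
        ∃ P' : (mordellCurve d).toAffine.Point, ∀ n : ℕ, n • P = 0 ↔ n • P' = 0 := by
  have hcoord : ∀ R : (mordellCurve (c : K)).toAffine.Point, ∃ x y : K, R ≠ 0 → IsPt R x y := by
    intro R
    rcases eq_zero_or_isPt R with h | ⟨x, y, h⟩
    · exact ⟨0, 0, fun h' => absurd h h'⟩
    · exact ⟨x, y, fun _ => h⟩
  choose X Y hXY using hcoord
  have hfin : (Set.range fun n : ℕ => n • P).Finite :=
    (finite_multiples.2 hP).subset (by
      rintro _ ⟨n, rfl⟩
      exact AddSubmonoid.mem_multiples_iff _ _ |>.2 ⟨n, rfl⟩)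
  -- The coordinates chosen for the zero point are arbitrary, and a vanishing denominator has
  -- inverse 0; both merely add harmless elements to `S`.
  let S : Finset K := {(c : K), (c : K)⁻¹} ∪ (hfin.toFinset.image X ∪ hfin.toFinset.image Y ∪
    hfin.toFinset.image (fun R => (X R - X P)⁻¹) ∪ hfin.toFinset.image (fun R => (2 * Y R)⁻¹))
  obtain ⟨N, hN0, hN⟩ := exists_integral_multiples ℤ ℚ S
  -- Beyond this bound the common denominator `N`, the denominator of c, and 2 and 3 are nonzero in
  -- the residue field.
  refine ⟨max (max N.natAbs c.den) 3, fun p hp hNp Q hQ hpQ => ?_⟩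
  let := Ideal.Quotient.field Q
  let : DecidableEq (𝓞 K ⧸ Q) := Classical.decEq _
  have hint : ∀ m : ℤ, m ≠ 0 → m.natAbs < p → (m : 𝓞 K) ∉ Q := by
    intro m hm hmp hmQ
    have hcop : IsCoprime m (p : ℤ) := by
      rw [Int.isCoprime_iff_gcd_eq_one, Int.gcd_comm]
      change Nat.gcd p m.natAbs = 1
      exact (Nat.Prime.coprime_iff_not_dvd hp).2 fun h =>
        absurd (Nat.le_of_dvd (by omega) h) (by omega)
    obtain ⟨a, b, hab⟩ := hcop
    refine hQ.ne_top ((Ideal.eq_top_iff_one Q).2 ?_)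
    have : (1 : 𝓞 K) = a * m + b * (p : 𝓞 K) := by exact_mod_cast congrArg (Int.cast (R := 𝓞 K)) hab.symm
    rw [this]
    exact Q.add_mem (Q.mul_mem_left _ hmQ) (Q.mul_mem_left _ hpQ)
  have hint' : ∀ m : ℤ, m ≠ 0 → m.natAbs < p → (m : 𝓞 K ⧸ Q) ≠ 0 := by
    intro m hm hmp h0
    refine hint m hm hmp (Ideal.Quotient.eq_zero_iff_mem.1 ?_)
    rw [map_intCast, h0]
  have hk2 : (2 : 𝓞 K ⧸ Q) ≠ 0 := by exact_mod_cast hint' 2 (by norm_num) (by simp; omega)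
  have hk3 : (3 : 𝓞 K ⧸ Q) ≠ 0 := by exact_mod_cast hint' 3 (by norm_num) (by simp; omega)
  have hk6 : (6 : 𝓞 K ⧸ Q) ≠ 0 := by
    rw [show (6 : 𝓞 K ⧸ Q) = 2 * 3 by norm_num]
    exact mul_ne_zero hk2 hk3
  refine ⟨hk6, ?_⟩
  have hi0 : ∀ y : Q.primeCompl, IsUnit (algebraMap (𝓞 K) K y) := by
    rintro ⟨y, hy⟩
    refine IsUnit.mk0 _ fun h => hy ?_
    have : y = 0 := by simpa using h
    rw [this]
    exact Q.zero_mem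
  have hφ0 : ∀ y : Q.primeCompl, IsUnit (Ideal.Quotient.mk Q y) := by
    rintro ⟨y, hy⟩
    exact IsUnit.mk0 _ fun h => hy (Ideal.Quotient.eq_zero_iff_mem.1 h)
  let A := Localization.AtPrime Q
  let i : A →+* K := IsLocalization.lift hi0
  let φ : A →+* 𝓞 K ⧸ Q := IsLocalization.lift hφ0
  have hi : Function.Injective i := by
    refine (IsLocalization.lift_injective_iff hi0).2 fun x y => ?_
    rw [(IsLocalization.injective A Q.primeCompl_le_nonZeroDivisors).eq_iff]
    exact (FaithfulSMul.algebraMap_injective (𝓞 K) K).eq_iff.symm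
  have hS : ∀ s ∈ S, ∃ a : A, i a = s := by
    intro s hs
    let t : 𝓞 K := ⟨N • s, hN s hs⟩
    refine ⟨IsLocalization.mk' A t (⟨(N : 𝓞 K), hint N hN0 (by omega)⟩ : Q.primeCompl), ?_⟩
    rw [IsLocalization.lift_mk'_spec]
    change N • s = algebraMap (𝓞 K) K (N : 𝓞 K) * s
    rw [map_intCast, zsmul_eq_mul]
  have hmem : ∀ n : ℕ, n • P ∈ hfin.toFinset := fun n => by simp
  have hcK : (c : K) ≠ 0 := by exact_mod_cast hc
  obtain ⟨c0, hc0⟩ := hS c (by simp [S])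
  obtain ⟨c1, hc1⟩ := hS (c : K)⁻¹ (by simp [S])
  have hc01 : c0 * c1 = 1 := hi (by rw [map_mul, hc0, hc1, mul_inv_cancel₀ hcK, map_one])
  have hd : φ c0 ≠ 0 := by
    intro h
    have := congrArg φ hc01
    simp [h] at this
  refine ⟨φ c0, hd, ⟨c.num, c.den, hint' _ (by simp) (by simp; omega), ?_⟩, ?_⟩
  · rw [← map_intCast φ, ← map_intCast φ, ← map_mul]
    congr 1
    apply hi
    rw [map_mul, hc0, map_intCast, map_intCast, Int.cast_natCast]
    exact_mod_cast Rat.den_mul_eq_num c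
  · by_cases hP0 : P = 0
    · exact ⟨0, by simp [hP0]⟩
    have hXYn : ∀ n : ℕ, n • P ≠ 0 → ∃ a b, IsPt (n • P) (i a) (i b) := by
      intro n hn
      obtain ⟨a, ha⟩ := hS (X (n • P)) (by simp [S])
      obtain ⟨b, hb⟩ := hS (Y (n • P)) (by simp [S])
      exact ⟨a, b, by rw [ha, hb]; exact hXY _ hn⟩
    obtain ⟨a, b, hab⟩ := hXYn 1 (by simpa using hP0)
    rw [one_nsmul] at hab
    have heq : b ^ 2 = a ^ 3 + c0 := hi (by simpa [hc0] using hab.eqn)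
    obtain ⟨P', hP'⟩ := exists_isPt hk6 hd (x := φ a) (y := φ b)
      (by simpa using congrArg φ heq)
    refine ⟨P', fun n => Reduces.eq_zero_iff (i := i) (φ := φ) ?_⟩
    -- Adding P one copy at a time, the only slope denominators are x(nP) - x(P) and 2y(P).
    induction n with
    | zero => exact .inl ⟨by simp, by simp⟩
    | succ n ih =>
      rw [succ_nsmul, succ_nsmul]
      have hunit : ∀ z : A, (i z)⁻¹ ∈ S → z ≠ 0 → IsUnit z := by
        intro z hz hz0
        obtain ⟨w, hw⟩ := hS _ hz
        refine IsUnit.of_mul_eq_one w (hi ?_)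
        rw [map_mul, hw, mul_inv_cancel₀, map_one]
        exact fun h => hz0 (hi (by simpa using h))
      refine Reduces.add hi hk2 ih (.inr ⟨a, b, hab, hP'⟩) ?_ ?_
      · intro a₁ b₁ a₂ b₂ h1 h2 hne
        refine hunit _ ?_ (sub_ne_zero.2 hne)
        rw [map_sub, (h1.inj (hXY _ h1.ne_zero)).1, (h2.inj (hXY _ h2.ne_zero)).1]
        simp only [S, Finset.mem_union]
        exact .inr (.inl (.inr (Finset.mem_image_of_mem (fun R => (X R - X P)⁻¹) (hmem n))))
      · intro a₁ b₁ h1 hne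
        refine hunit _ ?_ ?_
        · rw [map_mul, (h1.inj (hXY _ h1.ne_zero)).2, map_ofNat]
          simp only [S, Finset.mem_union]
          refine .inr (.inr (Finset.mem_image_of_mem (fun R => (2 * Y R)⁻¹) ?_))
          simpa using hmem 1
        · intro h
          have := congrArg i h
          simp only [map_mul, map_ofNat, map_zero, mul_eq_zero, OfNat.ofNat_ne_zero, false_or] at this
          exact hne (hi (by rw [this, map_zero]))

end NumberFieldReduction

/-! ### The exponent of the torsion divides 18. -/

section Exponent

open NumberField

variable {K : Type*} [Field K] [NumberField K] [DecidableEq K]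

/-- For residue degrees 1, 2, 3, 6 the reduced point is killed by p + 1, 2(p + 1), p³ + 1, 2(p³ +
1). All of these divide 2(p³ + 1), because p + 1 divides p³ + 1. -/
theorem exists_nsmul_eq_zero (hK : Module.finrank ℚ K = 3 ∨ Module.finrank ℚ K = 6)
    {c : ℚ} (hc : c ≠ 0) {P : (mordellCurve (c : K)).toAffine.Point} (hP : IsOfFinAddOrder P) :
    ∃ N : ℕ, ∀ p : ℕ, p.Prime → N < p → p % 3 = 2 →
      (2 * (p ^ 3 + 1)) • P = 0 ∧ (p % 4 = 1 → 4 • P = 0 → 2 • P = 0) := by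
  obtain ⟨N, hN⟩ := exists_good_reduction hc hP
  refine ⟨N, fun p hp hNp hp3 => ?_⟩
  obtain ⟨Q, hQ, hpQ, f, hf, hcard⟩ := exists_prime_over_natCard hK hp
  obtain ⟨h6, d, hd, ⟨u, v, hv, hvd⟩, P', hP'⟩ := hN p hp hNp Q hpQ
  let := Ideal.Quotient.field Q
  let : DecidableEq (𝓞 K ⧸ Q) := Classical.decEq _
  have := Fact.mk hp
  have : CharP (𝓞 K ⧸ Q) p := (CharP.charP_iff_prime_eq_zero hp).2 (by
    rw [← map_natCast (Ideal.Quotient.mk Q), Ideal.Quotient.eq_zero_iff_mem]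
    exact hpQ)
  have hfin : Finite (𝓞 K ⧸ Q) :=
    Nat.finite_of_card_ne_zero (by rw [hcard]; exact pow_ne_zero _ hp.ne_zero)
  -- Frobenius fixes the integers u and v, hence also d.
  have hdp : d ^ p = d := by
    have h := congrArg (frobenius (𝓞 K ⧸ Q) p) hvd
    rw [map_mul, map_intCast, map_intCast, frobenius_def, ← hvd] at h
    exact mul_left_cancel₀ hv h
  have hp33 : p ^ 3 % 3 = 2 := by rw [Nat.pow_mod, hp3]
  have hp34 : p % 4 = 1 → p ^ 3 % 4 = 1 := fun h => by rw [Nat.pow_mod, h]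
  simp only [hP']
  have four : ∀ m : ℕ, m % 4 = 2 → m • P' = 0 → 4 • P' = 0 → 2 • P' = 0 := by
    intro m hm h1 h4
    obtain ⟨t, rfl⟩ : ∃ t, m = 4 * t + 2 := ⟨m / 4, by omega⟩
    rwa [add_nsmul, mul_comm 4, mul_nsmul', h4, nsmul_zero, zero_add] at h1
  have dvd : ∀ m n : ℕ, m ∣ n → m • P' = 0 → n • P' = 0 := by
    rintro m _ ⟨t, rfl⟩ h
    rw [mul_nsmul, h, nsmul_zero]
  have hdvd : p + 1 ∣ p ^ 3 + 1 := ⟨p ^ 2 - p + 1, by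
    have : p ≤ p ^ 2 := Nat.le_self_pow two_ne_zero p
    zify [this]
    ring⟩
  rcases hf with rfl | rfl | rfl | rfl
  · have := nsmul_eq_zero_of_card_eq h6 hd hp3 (by rw [hcard, pow_one]) P'
    exact ⟨dvd _ _ (hdvd.mul_left 2) this, fun h => four _ (by omega) this⟩
  · have := nsmul_eq_zero_of_card_eq_sq h6 hd hp3 (frobenius _ p) (fun x => rfl) hdp hcard P'
    exact ⟨dvd _ _ (mul_dvd_mul_left 2 hdvd) this.1, this.2⟩
  · have := nsmul_eq_zero_of_card_eq h6 hd hp33 hcard P'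
    exact ⟨dvd _ _ (dvd_mul_left _ _) this, fun h => four _ (by have := hp34 h; omega) this⟩
  · have := nsmul_eq_zero_of_card_eq_sq h6 hd hp33 (iterateFrobenius _ p 3)
      (fun x => iterateFrobenius_def ..) (by rw [pow_succ, pow_two, pow_mul, pow_mul, hdp, hdp, hdp])
      (by rw [hcard, ← pow_mul]) P'
    exact ⟨this.1, fun h => this.2 (hp34 h)⟩

/-- Each forbidden order gets its own progression inside p ≡ 2 mod 3. For order 4, p ≡ 5 mod 12
gives p ≡ 1 mod 4. For 27, p ≡ 2 mod 27 gives 2(p³ + 1) ≡ 18. For a prime l ≥ 5, p ≡ 1 mod l gives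
2(p³ + 1) ≡ 4, which l does not divide. -/
theorem nsmul_eighteen_eq_zero (hK : Module.finrank ℚ K = 3 ∨ Module.finrank ℚ K = 6)
    {c : ℚ} (hc : c ≠ 0) {P : (mordellCurve (c : K)).toAffine.Point} (hP : IsOfFinAddOrder P) :
    18 • P = 0 := by
  rw [← addOrderOf_dvd_iff_nsmul_eq_zero, Nat.dvd_iff_prime_pow_dvd_dvd]
  have key : ∀ m, m ∣ addOrderOf P → m ≠ 0 →
      ∃ R : (mordellCurve (c : K)).toAffine.Point, addOrderOf R = m ∧ IsOfFinAddOrder R := by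
    intro m hm hm0
    have hn0 : addOrderOf P ≠ 0 := (addOrderOf_pos_iff.2 hP).ne'
    have h : addOrderOf ((addOrderOf P / m) • P) = m := by
      rw [addOrderOf_nsmul_of_dvd (Nat.div_ne_zero_iff_of_dvd hm |>.2 ⟨hn0, hm0⟩)
        (Nat.div_dvd_of_dvd hm), Nat.div_div_self hm hn0]
    exact ⟨_, h, addOrderOf_pos_iff.1 (by omega)⟩
  have no4 : ¬ 4 ∣ addOrderOf P := by
    intro h
    obtain ⟨R, hR, hRf⟩ := key 4 h (by norm_num)
    obtain ⟨N, hN⟩ := exists_nsmul_eq_zero hK hc hRf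
    obtain ⟨p, hpN, hp, hmod⟩ := Nat.forall_exists_prime_gt_and_modEq N (q := 12) (a := 5)
      (by norm_num) (by norm_num)
    change p % 12 = 5 % 12 at hmod
    have := (hN p hp hpN (by omega)).2 (by omega) (by
      rw [← addOrderOf_dvd_iff_nsmul_eq_zero, hR])
    rw [← addOrderOf_dvd_iff_nsmul_eq_zero, hR] at this
    omega
  have no27 : ¬ 27 ∣ addOrderOf P := by
    intro h
    obtain ⟨R, hR, hRf⟩ := key 27 h (by norm_num)
    obtain ⟨N, hN⟩ := exists_nsmul_eq_zero hK hc hRf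
    obtain ⟨p, hpN, hp, hmod⟩ := Nat.forall_exists_prime_gt_and_modEq N (q := 27) (a := 2)
      (by norm_num) (by norm_num)
    have h1 := (hN p hp hpN (by change p % 27 = 2 % 27 at hmod; omega)).1
    rw [← addOrderOf_dvd_iff_nsmul_eq_zero, hR] at h1
    have h2 : 2 * (p ^ 3 + 1) ≡ 2 * (2 ^ 3 + 1) [MOD 27] := ((hmod.pow 3).add_right 1).mul_left 2
    have h3 := (h2.dvd_iff (dvd_refl 27)).1 h1
    omega
  have no_big : ∀ l, l.Prime → 5 ≤ l → ¬ l ∣ addOrderOf P := by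
    intro l hl hl5 h
    obtain ⟨R, hR, hRf⟩ := key l h hl.ne_zero
    obtain ⟨N, hN⟩ := exists_nsmul_eq_zero hK hc hRf
    have hcop : Nat.Coprime 3 l := (Nat.coprime_primes Nat.prime_three hl).2 (by omega)
    obtain ⟨a, ha3, hal⟩ := Nat.chineseRemainder hcop 2 1
    obtain ⟨p, hpN, hp, hmod⟩ := Nat.forall_exists_prime_gt_and_modEq N (q := 3 * l) (a := a)
      (by omega) (Nat.Coprime.mul_right
        (by rw [Nat.Coprime, ha3.gcd_eq]; norm_num)
        (by rw [Nat.Coprime, hal.gcd_eq]; simp))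
    have hp3 : p ≡ 2 [MOD 3] := (hmod.of_mul_right l).trans ha3
    have hpl : p ≡ 1 [MOD l] := (hmod.of_mul_left 3).trans hal
    have h1 := (hN p hp hpN hp3).1
    rw [← addOrderOf_dvd_iff_nsmul_eq_zero, hR] at h1
    have h2 : 2 * (p ^ 3 + 1) ≡ 2 * (1 ^ 3 + 1) [MOD l] := ((hpl.pow 3).add_right 1).mul_left 2
    have h3 := (h2.dvd_iff (dvd_refl l)).1 h1
    exact absurd (Nat.le_of_dvd (by norm_num) h3) (by omega)
  intro l k hl hlk
  rcases Nat.eq_zero_or_pos k with rfl | hk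
  · simp
  rcases lt_or_ge l 5 with h5 | h5
  · have := hl.two_le
    interval_cases l
    · have : k < 2 := by
        by_contra! h
        exact no4 ((pow_dvd_pow 2 h).trans hlk)
      interval_cases k
      norm_num
    · have : k < 3 := by
        by_contra! h
        exact no27 ((pow_dvd_pow 3 h).trans hlk)
      interval_cases k <;> norm_num
    · exact absurd hl (by norm_num)
  · exact absurd ((dvd_pow_self l hk.ne').trans hlk) (no_big l hl h5)

end Exponent

/-! ### Division polynomials for 2, 3 and 9. -/

section TorsionPoints

variable {K : Type*} [Field K] [CharZero K] [DecidableEq K] {c : K}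
  {P : (mordellCurve c).toAffine.Point} {x y : K}

theorem IsPt.two_nsmul_eq_zero_iff (h : IsPt P x y) : 2 • P = 0 ↔ y = 0 := by
  rw [two_nsmul, ← eq_neg_iff_add_eq_zero]
  constructor
  · intro e
    have h' := h.neg
    rw [← e] at h'
    exact self_eq_neg.1 (h.inj h').2
  · rintro rfl
    exact h.eq (by simpa using h.neg)

/-- 3P = 0 means 2P = -P, that is x(2P) = x(P), since 2P = P is impossible for P ≠ 0. The difference
of these coordinates is -3x(x³ + 4c)/(4y²). -/
theorem IsPt.three_nsmul_eq_zero_iff (hc : c ≠ 0) (h : IsPt P x y) :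
    3 • P = 0 ↔ x * (x ^ 3 + 4 * c) = 0 := by
  have he := h.eqn
  by_cases hy : y = 0
  · have h2 := h.two_nsmul_eq_zero_iff.2 hy
    rw [succ_nsmul, h2, zero_add]
    subst hy
    have h3 : x ^ 3 + 4 * c = 3 * c := by linear_combination -he
    rw [h3]
    refine iff_of_false h.ne_zero fun h0 => ?_
    have hx : x = 0 := by simpa [hc] using h0
    subst hx
    exact hc (by linear_combination -he)
  · have hd := h.double two_ne_zero hy (l := 3 * x ^ 2 / (2 * y)) (by field_simp)
    have hx2 : (3 * x ^ 2 / (2 * y)) ^ 2 - x - x = x ↔ x * (x ^ 3 + 4 * c) = 0 := by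
      rw [← sub_eq_zero, show (3 * x ^ 2 / (2 * y)) ^ 2 - x - x - x =
        -3 * (x * (x ^ 3 + 4 * c)) / (4 * y ^ 2) by field_simp; linear_combination -48 * x * he]
      simp [hy]
    rw [← hx2, succ_nsmul, two_nsmul, ← eq_neg_iff_add_eq_zero]
    constructor
    · intro e
      rw [e] at hd
      exact (hd.inj h.neg).1
    · intro e
      rw [e] at hd
      rcases hd.eq_or_eq_neg h with e' | e'
      · exact absurd (by simpa using e') h.ne_zero
      · exact e'

/-- The tripling formula for x, with the square of the 3-division polynomial 3x(x³ + 4c) as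
denominator. Cleared of it, the formula also covers y = 0, where 3P = P. -/
theorem IsPt.three_nsmul (hc : c ≠ 0) (h : IsPt P x y) {X Y : K} (h3 : IsPt (3 • P) X Y) :
    X * (9 * x ^ 2 * (x ^ 3 + 4 * c) ^ 2) =
      x ^ 9 - 96 * c * x ^ 6 + 48 * c ^ 2 * x ^ 3 + 64 * c ^ 3 := by
  have he := h.eqn
  by_cases hy : y = 0
  · have h2 := h.two_nsmul_eq_zero_iff.2 hy
    rw [succ_nsmul, h2, zero_add] at h3
    obtain ⟨rfl, -⟩ := h.inj h3
    subst hy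
    have hx : x ^ 3 = -c := by linear_combination -he
    have h9 : x ^ 9 = -c ^ 3 := by rw [show x ^ 9 = (x ^ 3) ^ 3 by ring, hx]; ring
    have h6 : x ^ 6 = c ^ 2 := by rw [show x ^ 6 = (x ^ 3) ^ 2 by ring, hx]; ring
    rw [h9, h6, hx]
    linear_combination (9 * 9 * c ^ 2) * hx
  · have hne : x * (x ^ 3 + 4 * c) ≠ 0 := fun h0 =>
      h3.ne_zero ((h.three_nsmul_eq_zero_iff hc).2 h0)
    have hx0 : x ≠ 0 := left_ne_zero_of_mul hne
    have hD0 : x ^ 3 + 4 * c ≠ 0 := right_ne_zero_of_mul hne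
    have hd := h.double two_ne_zero hy (l := 3 * x ^ 2 / (2 * y)) (by field_simp)
    have hsub : (3 * x ^ 2 / (2 * y)) ^ 2 - x - x - x =
        -3 * (x * (x ^ 3 + 4 * c)) / (4 * y ^ 2) := by
      field_simp
      linear_combination -48 * he
    have hx2 : (3 * x ^ 2 / (2 * y)) ^ 2 - x - x ≠ x := by
      rw [← sub_ne_zero, hsub]
      exact div_ne_zero (mul_ne_zero (by norm_num) hne) (by simp [hy])
    -- With λ the tangent slope, y(2P) - y = -λ(x(2P) - x) - 2y; dividing by x(2P) - x gives this
    -- slope.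
    have ht := hd.add h hx2 (l := -(3 * x ^ 2 / (2 * y)) + 8 * y ^ 3 / (3 * x * (x ^ 3 + 4 * c))) (by
      rw [hsub]
      field_simp
      ring)
    rw [← two_nsmul, ← succ_nsmul] at ht
    rw [(h3.inj ht).1]
    have hs : y ^ 6 = (x ^ 3 + c) ^ 3 := by rw [← he]; ring
    have : (-(3 * x ^ 2 / (2 * y)) + 8 * y ^ 3 / (3 * x * (x ^ 3 + 4 * c))) ^ 2 -
        ((3 * x ^ 2 / (2 * y)) ^ 2 - x - x) - x =
        64 * y ^ 6 / (9 * x ^ 2 * (x ^ 3 + 4 * c) ^ 2) - 8 * x * y ^ 2 / (x ^ 3 + 4 * c) + x := by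
      field_simp
      ring
    have clear : ∀ D : K, D ≠ 0 → ∀ s : K, (64 * s ^ 3 / (9 * x ^ 2 * D ^ 2) - 8 * x * s / D + x) *
        (9 * x ^ 2 * D ^ 2) = 64 * s ^ 3 - 72 * x ^ 3 * s * D + 9 * x ^ 3 * D ^ 2 := by
      intro D hD s
      field_simp
      ring
    rw [this, hs, he, clear _ hD0]
    ring

theorem three_nsmul_eq_zero_cases (hc : c ≠ 0) (h : IsPt P x y) (h3 : 3 • P = 0) :
    (x = 0 ∧ y ^ 2 = c) ∨ (x ^ 3 = -4 * c ∧ y ^ 2 = -3 * c) := by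
  have he := h.eqn
  rcases mul_eq_zero.1 ((h.three_nsmul_eq_zero_iff hc).1 h3) with e | e
  · subst e
    exact .inl ⟨rfl, by linear_combination he⟩
  · exact .inr ⟨by linear_combination e, by linear_combination he + e⟩

/-- A point of order nine lying over `(0, ±√c)`. -/
theorem exists_root_of_three_nsmul_x_eq_zero (hc : c ≠ 0) (h : IsPt P x y) {Y : K}
    (h3 : IsPt (3 • P) 0 Y) :
    IsSquare c ∧ IsCube (4 * c) ∧ HasR K := by
  have hx := h.three_nsmul hc h3
  have hcx : x ≠ 0 := by
    rintro rfl
    exact hc (by simpa using hx.symm)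
  -- In terms of v, the numerator of the tripling formula is 64c³((v + 1)³ - 27v²).
  set v := x ^ 3 / (4 * c) with hv
  have hxv : x ^ 3 = 4 * c * v := by rw [hv]; field_simp
  have hveq : (v + 1) ^ 3 = 27 * v ^ 2 := by
    have : 64 * c ^ 3 * ((v + 1) ^ 3 - 27 * v ^ 2) = 0 := by
      rw [show x ^ 9 = (x ^ 3) ^ 3 by ring, show x ^ 6 = (x ^ 3) ^ 2 by ring, hxv] at hx
      linear_combination -hx
    exact sub_eq_zero.1 ((mul_eq_zero.1 this).resolve_left (by simp [hc]))
  have hv0 : v ≠ 0 := by simp [hv, hcx, hc]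
  have hv1 : v + 1 ≠ 0 := by
    intro h0
    rw [h0] at hveq
    simp [hv0] at hveq
  -- The relation (v + 1)³ = 27v² is parametrized by r = 3v/(v + 1): v = r³ and v + 1 = 3r². Hence r
  -- is the required root and x/r is a cube root of 4c.
  have hr3 : (3 * v / (v + 1)) ^ 3 = v := by
    rw [div_pow, hveq]
    field_simp
    ring
  have hr2 : 3 * (3 * v / (v + 1)) ^ 2 = v + 1 := by
    rw [div_pow]
    field_simp
    linear_combination -hveq
  refine ⟨⟨Y, by linear_combination -h3.eqn⟩, ⟨x / (3 * v / (v + 1)), ?_⟩, 3 * v / (v + 1), ?_⟩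
  · rw [div_pow, hr3, hxv]
    field_simp
  · rw [hr3, hr2]
    ring

/-- A point of order nine lying over a `3`-torsion point `(X, ±√(-3c))`, `X ^ 3 = -4c`. -/
theorem exists_root_of_three_nsmul_x_ne_zero (hc : c ≠ 0) (h : IsPt P x y) {X Y : K}
    (h3 : IsPt (3 • P) X Y) (hX : X ^ 3 = -4 * c) :
    ∃ r w : K, r ^ 3 - 3 * r ^ 2 + 1 = 0 ∧ w ^ 3 + 3 * r * w ^ 2 + 1 = 0 := by
  have hx := h.three_nsmul hc h3
  have hX0 : X ≠ 0 := by
    rintro rfl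
    exact hc (by simpa using hX.symm)
  have hcX : c = -X ^ 3 / 4 := by rw [hX]; field_simp
  set w := -x / X with hw
  have hxw : x = -w * X := by rw [hw]; field_simp
  have hweq : (w ^ 3 + 1) ^ 3 + 3 * (w ^ 3 + 1) ^ 2 * (3 * w ^ 2) - (3 * w ^ 2) ^ 3 = 0 := by
    have : X ^ 9 * ((w ^ 3 + 1) ^ 3 + 3 * (w ^ 3 + 1) ^ 2 * (3 * w ^ 2) - (3 * w ^ 2) ^ 3) = 0 := by
      rw [hxw, hcX] at hx
      linear_combination hx
    exact (mul_eq_zero.1 this).resolve_left (pow_ne_zero _ hX0)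
  have hw0 : w ≠ 0 := by
    intro h0
    rw [h0] at hweq
    simp at hweq
  -- The equation for w is homogeneous of degree 3 in w³ + 1 and 3w²; r is minus their ratio.
  refine ⟨-(w ^ 3 + 1) / (3 * w ^ 2), w, ?_, ?_⟩
  · field_simp
    linear_combination -hweq
  · field_simp
    ring

end TorsionPoints

/-! ### Recognizing small abelian groups from generators. -/

section Groups

variable {G : Type*} [AddCommGroup G]

/-- The subgroup of elements killed by `n`. -/
def killedBy (G : Type*) [AddCommGroup G] (n : ℕ) : AddSubgroup G :=
  (nsmulAddMonoidHom (α := G) n).ker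

theorem mem_killedBy {n : ℕ} {g : G} : g ∈ killedBy G n ↔ n • g = 0 := Iff.rfl

theorem torsion_equiv_prod (h : ∀ g : G, IsOfFinAddOrder g → 18 • g = 0) :
    Nonempty (AddCommGroup.torsion G ≃+ killedBy G 2 × killedBy G 9) := by
  have key : ∀ {n : ℕ} (g : killedBy G n), n ≠ 0 → IsOfFinAddOrder g.1 := fun g hn =>
    isOfFinAddOrder_iff_nsmul_eq_zero.2 ⟨_, Nat.pos_of_ne_zero hn, g.2⟩
  let f : killedBy G 2 × killedBy G 9 →+ AddCommGroup.torsion G :=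
    AddMonoidHom.mk' (fun g => ⟨g.1.1 + g.2.1,
      (AddCommGroup.torsion G).add_mem (key g.1 two_ne_zero) (key g.2 (by norm_num))⟩)
      (fun a b => Subtype.ext (by simp; abel))
  refine ⟨(AddEquiv.ofBijective f ⟨?_, ?_⟩).symm⟩
  · refine (injective_iff_map_eq_zero f).2 ?_
    rintro ⟨⟨a, ha⟩, ⟨b, hb⟩⟩ hab
    have h0 : a + b = 0 := congrArg Subtype.val hab
    have ha' : 2 • a = 0 := ha
    have hb' : 9 • b = 0 := hb
    have hb0 : b = 0 := calc
      b = 9 • b - 4 • (2 • (a + b) - 2 • a) := by abel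
      _ = 0 := by rw [hb', h0, ha']; simp
    have ha0 : a = 0 := by simpa [hb0] using h0
    subst ha0 hb0
    rfl
  · rintro ⟨g, hg⟩
    have hg' := h g hg
    refine ⟨⟨⟨9 • g, ?_⟩, ⟨-(8 • g), ?_⟩⟩, Subtype.ext ?_⟩
    · rw [mem_killedBy, ← mul_nsmul, hg']
    · have e : (9 : ℕ) • -((8 : ℕ) • g) = -((4 : ℕ) • ((18 : ℕ) • g)) := by module
      rw [mem_killedBy, e, hg', nsmul_zero, neg_zero]
    · change (9 : ℕ) • g + -((8 : ℕ) • g) = g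
      module

theorem equiv_zmod_prod {H : AddSubgroup G} {a b : G} {n m : ℕ} (ha : a ∈ H) (hb : b ∈ H)
    (hna : n • a = 0) (hmb : m • b = 0)
    (hspan : ∀ g ∈ H, ∃ k l : ℤ, g = k • a + l • b)
    (hind : ∀ k l : ℤ, k • a + l • b = 0 → (n : ℤ) ∣ k ∧ (m : ℤ) ∣ l) :
    Nonempty (H ≃+ ZMod n × ZMod m) := by
  let fa : ZMod n →+ H := ZMod.lift n ⟨zmultiplesHom H ⟨a, ha⟩, Subtype.ext (by
    simpa using hna)⟩
  let fb : ZMod m →+ H := ZMod.lift m ⟨zmultiplesHom H ⟨b, hb⟩, Subtype.ext (by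
    simpa using hmb)⟩
  have hf : ∀ k l : ℤ, ((fa.coprod fb ((k : ZMod n), (l : ZMod m)) : H) : G) = k • a + l • b := by
    intro k l
    simp [fa, fb]
  refine ⟨(AddEquiv.ofBijective (fa.coprod fb) ⟨?_, ?_⟩).symm⟩
  · refine (injective_iff_map_eq_zero _).2 ?_
    rintro ⟨k, l⟩ h
    obtain ⟨k, rfl⟩ := ZMod.intCast_surjective k
    obtain ⟨l, rfl⟩ := ZMod.intCast_surjective l
    have := hind k l (by rw [← hf, h]; rfl)
    rw [Prod.mk_eq_zero]
    exact ⟨(ZMod.intCast_zmod_eq_zero_iff_dvd _ _).2 this.1,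
      (ZMod.intCast_zmod_eq_zero_iff_dvd _ _).2 this.2⟩
  · rintro ⟨g, hg⟩
    obtain ⟨k, l, rfl⟩ := hspan g hg
    exact ⟨(k, l), Subtype.ext (hf k l)⟩

theorem equiv_zmod {H : AddSubgroup G} {a : G} {n : ℕ} (ha : a ∈ H) (hn : addOrderOf a = n)
    (hspan : ∀ g ∈ H, ∃ k : ℤ, g = k • a) : Nonempty (H ≃+ ZMod n) := by
  obtain ⟨e⟩ := equiv_zmod_prod (n := n) (m := 1) ha H.zero_mem (by rw [← hn, addOrderOf_nsmul_eq_zero])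
    (by simp) (fun g hg => (hspan g hg).imp fun k hk => ⟨0, by simp [hk]⟩)
    (fun k l hkl => ⟨by
      rw [← hn, addOrderOf_dvd_iff_zsmul_eq_zero]
      simpa using hkl, by simp⟩)
  exact ⟨e.trans AddEquiv.prodUnique⟩

theorem equiv_zmod_one {H : AddSubgroup G} (h : ∀ g ∈ H, g = 0) : Nonempty (H ≃+ ZMod 1) :=
  equiv_zmod H.zero_mem addOrderOf_zero fun g hg => ⟨0, by simp [h g hg]⟩

/-- Independence reduces to b ∉ ⟨a⟩: in a relation ka + lb = 0 with p ∤ l, Bézout would express b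
through a. -/
theorem equiv_zmod_prod_prime {H : AddSubgroup G} {a b : G} {n p : ℕ} (hp : p.Prime) (ha : a ∈ H)
    (hb : b ∈ H) (hn : addOrderOf a = n) (hpb : p • b = 0) (hab : b ∉ AddSubgroup.zmultiples a)
    (hspan : ∀ g ∈ H, ∃ k l : ℤ, g = k • a + l • b) :
    Nonempty (H ≃+ ZMod n × ZMod p) := by
  refine equiv_zmod_prod ha hb (by rw [← hn, addOrderOf_nsmul_eq_zero]) hpb hspan fun k l hkl => ?_
  have hl : (p : ℤ) ∣ l := by
    by_contra hl
    obtain ⟨u, v, huv⟩ := ((Nat.prime_iff_prime_int.1 hp).irreducible.coprime_iff_not_dvd).2 hl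
    refine hab (AddSubgroup.mem_zmultiples_iff.2 ⟨-(v * k), ?_⟩)
    have h1 : v • (k • a + l • b) + u • ((p : ℤ) • b) = 0 := by
      rw [hkl, natCast_zsmul, hpb]; simp
    have h2 : v • (k • a + l • b) + u • ((p : ℤ) • b) = (v * k) • a + (u * p + v * l) • b := by
      module
    rw [h2, huv, one_zsmul] at h1
    rw [neg_zsmul]
    exact neg_eq_of_add_eq_zero_right h1
  refine ⟨?_, hl⟩
  obtain ⟨t, rfl⟩ := hl
  rw [mul_comm, mul_zsmul, natCast_zsmul, hpb, zsmul_zero, add_zero] at hkl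
  rwa [← hn, addOrderOf_dvd_iff_zsmul_eq_zero]

end Groups

/-! ### Cube roots of unity. -/

section CubeRoots

variable {K : Type*} [Field K] [CharZero K]

theorem hasOmega_iff : HasOmega K ↔ ∃ ω : K, ω ^ 2 + ω + 1 = 0 := by
  constructor
  · rintro ⟨ω, h⟩
    refine ⟨ω, ?_⟩
    have h1 : (ω - 1) * (ω ^ 2 + ω + 1) = 0 := by linear_combination h.pow_eq_one
    exact (mul_eq_zero.1 h1).resolve_left (sub_ne_zero.2 (h.ne_one (by norm_num)))
  · rintro ⟨ω, h⟩
    refine ⟨ω, IsPrimitiveRoot.of_map_of_injective (f := RingHom.id K) ?_ Function.injective_id⟩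
    have h3 : ω ^ 3 = 1 := by linear_combination (ω - 1) * h
    have h1 : ω ≠ 1 := by
      rintro rfl
      norm_num at h
    have := Fact.mk Nat.prime_three
    rw [RingHom.id_apply, ← orderOf_eq_prime h3 h1]
    exact IsPrimitiveRoot.orderOf ω

theorem hasOmega_iff_isSquare : HasOmega K ↔ IsSquare (-3 : K) := by
  rw [hasOmega_iff]
  constructor
  · rintro ⟨ω, h⟩
    exact ⟨2 * ω + 1, by linear_combination -4 * h⟩
  · rintro ⟨s, h⟩
    exact ⟨(-1 + s) / 2, by linear_combination -h / 4⟩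

theorem eq_of_pow_three_eq (hω : ¬ HasOmega K) {x y : K} (h : x ^ 3 = y ^ 3) : x = y := by
  by_contra hxy
  have h1 : (x - y) * (x ^ 2 + x * y + y ^ 2) = 0 := by linear_combination h
  have h2 := (mul_eq_zero.1 h1).resolve_left (sub_ne_zero.2 hxy)
  have hy : y ≠ 0 := by
    rintro rfl
    exact hxy (by simpa using h)
  exact hω (hasOmega_iff.2 ⟨x / y, by field_simp; linear_combination h2⟩)

end CubeRoots

theorem eq_or_of_pow_three_eq {K : Type*} [Field K] {ω : K} (hω : ω ^ 2 + ω + 1 = 0) {x y : K} (h : x ^ 3 = y ^ 3) :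
    x = y ∨ x = ω * y ∨ x = ω ^ 2 * y := by
  have h1 : (x - y) * ((x - ω * y) * (x - ω ^ 2 * y)) = 0 := by
    linear_combination h + (-(x ^ 2 * y) + x * y ^ 2 * ω - (ω - 1) * y ^ 3 ) * hω
  simpa [sub_eq_zero] using h1

/-! ### The 2-torsion subgroup. -/

section TwoTorsion

variable {K : Type*} [Field K] [CharZero K] [DecidableEq K] {c : K}

theorem exists_isPt_of_two_nsmul {P : (mordellCurve c).toAffine.Point} (h : 2 • P = 0)
    (h0 : P ≠ 0) : ∃ x, IsPt P x 0 ∧ x ^ 3 = -c := by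
  obtain ⟨x, y, hP⟩ := (eq_zero_or_isPt P).resolve_left h0
  obtain rfl := hP.two_nsmul_eq_zero_iff.1 h
  exact ⟨x, hP, by linear_combination -hP.eqn⟩

theorem two_torsion_trivial (hcub : ¬ IsCube c) :
    Nonempty (killedBy (mordellCurve c).toAffine.Point 2 ≃+ ZMod 1) := by
  refine equiv_zmod_one fun P hP => ?_
  by_contra h0
  obtain ⟨x, -, hx⟩ := exists_isPt_of_two_nsmul hP h0
  exact hcub ⟨-x, by linear_combination -hx⟩

theorem addOrderOf_eq_two {P : (mordellCurve c).toAffine.Point} {x : K} (h : IsPt P x 0) :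
    addOrderOf P = 2 :=
  have := Fact.mk Nat.prime_two
  addOrderOf_eq_prime (h.two_nsmul_eq_zero_iff.2 rfl) h.ne_zero

theorem two_torsion_cyclic (hc : c ≠ 0) (hcub : IsCube c) (hω : ¬ HasOmega K) :
    Nonempty (killedBy (mordellCurve c).toAffine.Point 2 ≃+ ZMod 2) := by
  obtain ⟨b, hb⟩ := hcub
  obtain ⟨A, hA⟩ := exists_isPt (c := c) (x := -b) (y := 0) (by norm_num) hc (by rw [← hb]; ring)
  refine equiv_zmod (a := A) (hA.two_nsmul_eq_zero_iff.2 rfl) (addOrderOf_eq_two hA) fun P hP => ?_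
  by_cases h0 : P = 0
  · exact ⟨0, by simp [h0]⟩
  · obtain ⟨x, hx, hx3⟩ := exists_isPt_of_two_nsmul hP h0
    obtain rfl : x = -b := eq_of_pow_three_eq hω (by rw [hx3, ← hb]; ring)
    exact ⟨1, by rw [one_zsmul]; exact hx.eq hA⟩

theorem two_torsion_full (hc : c ≠ 0) (hcub : IsCube c) (hω : HasOmega K) :
    Nonempty (killedBy (mordellCurve c).toAffine.Point 2 ≃+ ZMod 2 × ZMod 2) := by
  obtain ⟨b, hb⟩ := hcub
  obtain ⟨ω, hω⟩ := hasOmega_iff.1 hω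
  have hω3 : ω ^ 3 = 1 := by linear_combination (ω - 1) * hω
  have hω1 : ω ≠ 1 := by
    rintro rfl
    norm_num at hω
  have hb0 : b ≠ 0 := by
    rintro rfl
    exact hc (by simpa using hb.symm)
  obtain ⟨A, hA⟩ := exists_isPt (c := c) (x := -b) (y := 0) (by norm_num) hc (by rw [← hb]; ring)
  obtain ⟨B, hB⟩ := exists_isPt (c := c) (x := ω * -b) (y := 0) (by norm_num) hc
    (by rw [← hb, mul_pow, hω3]; ring)
  have hne : -b ≠ ω * -b := by
    intro h
    have : (ω - 1) * b = 0 := by linear_combination h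
    exact (mul_ne_zero (sub_ne_zero.2 hω1) hb0) this
  have hA2 := hA.two_nsmul_eq_zero_iff.2 rfl
  have hB2 := hB.two_nsmul_eq_zero_iff.2 rfl
  have hAB : A ≠ B := by
    rintro rfl
    exact hne (hA.inj hB).1
  have hC0 : A + B ≠ 0 := by
    rw [Ne, add_eq_zero_iff_eq_neg]
    intro h
    exact hAB (h.trans (hB.neg.eq (by simpa using hB)))
  obtain ⟨x, hC, hx3⟩ := exists_isPt_of_two_nsmul (by rw [nsmul_add, hA2, hB2, add_zero]) hC0
  -- A + B differs from A and from B, so its abscissa is the remaining cube root of -c.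
  have hxC : x = ω ^ 2 * -b := by
    rcases eq_or_of_pow_three_eq hω (x := x) (y := -b) (by rw [hx3, ← hb]; ring) with rfl | rfl | h
    · exact absurd (by simpa using hC.eq hA) hB.ne_zero
    · exact absurd (by simpa using hC.eq hB) hA.ne_zero
    · exact h
  subst hxC
  refine equiv_zmod_prod_prime (a := A) (b := B) Nat.prime_two hA2 hB2 (addOrderOf_eq_two hA) hB2
    ?_ fun P hP => ?_
  · intro h
    obtain ⟨k, rfl⟩ := AddSubgroup.mem_zmultiples_iff.1 h
    rcases Int.even_or_odd' k with ⟨m, rfl | rfl⟩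
    · refine hB.ne_zero ?_
      rw [mul_comm, mul_zsmul, show (2 : ℤ) • A = (2 : ℕ) • A from natCast_zsmul A 2, hA2, zsmul_zero]
    · refine hAB ?_
      rw [add_zsmul, mul_comm, mul_zsmul, show (2 : ℤ) • A = (2 : ℕ) • A from natCast_zsmul A 2, hA2,
        zsmul_zero, zero_add, one_zsmul]
  · by_cases h0 : P = 0
    · exact ⟨0, 0, by simp [h0]⟩
    · obtain ⟨x, hx, hx3⟩ := exists_isPt_of_two_nsmul hP h0
      rcases eq_or_of_pow_three_eq hω (x := x) (y := -b) (by rw [hx3, ← hb]; ring) with rfl | rfl | rfl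
      · exact ⟨1, 0, by simpa using hx.eq hA⟩
      · exact ⟨0, 1, by simpa using hx.eq hB⟩
      · exact ⟨1, 1, by simpa using hx.eq hC⟩

end TwoTorsion

/-! ### Multiples of a 3-torsion point with x = 0. -/

section PointRelations

variable {K : Type*} [Field K] [DecidableEq K] {c : K}

theorem addOrderOf_eq_three {P : (mordellCurve c).toAffine.Point} (h : 3 • P = 0) (h0 : P ≠ 0) :
    addOrderOf P = 3 :=
  have := Fact.mk Nat.prime_three
  addOrderOf_eq_prime h h0

theorem exists_zsmul_of_x_eq {P Q : (mordellCurve c).toAffine.Point} {x y y' : K} (h : IsPt P x y)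
    (h' : IsPt Q x y') : ∃ k : ℤ, Q = k • P := by
  rcases h'.eq_or_eq_neg h with rfl | rfl
  · exact ⟨1, by simp⟩
  · exact ⟨-1, by simp⟩

/-- The multiples of A are 0 and ±A, and the nonzero ones have x = 0. -/
theorem not_mem_zmultiples_of_x {A B : (mordellCurve c).toAffine.Point} {x y e : K}
    (hA : IsPt A 0 y) (hB : IsPt B x e) (hx : x ≠ 0) (hA3 : 3 • A = 0) :
    B ∉ AddSubgroup.zmultiples A := by
  intro h
  obtain ⟨k, rfl⟩ := AddSubgroup.mem_zmultiples_iff.1 h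
  have hA3' : (3 : ℤ) • A = 0 := (natCast_zsmul A 3).trans hA3
  have hk : k • A = (k % 3) • A := by
    conv_lhs => rw [← Int.mul_ediv_add_emod k 3]
    rw [add_zsmul, mul_comm, mul_zsmul, hA3', zsmul_zero, zero_add]
  rw [hk] at hB
  have : k % 3 = 0 ∨ k % 3 = 1 ∨ k % 3 = 2 := by omega
  rcases this with h | h | h <;> rw [h] at hB
  · exact hB.ne_zero (by simp)
  · rw [one_zsmul] at hB
    exact hx (hB.inj hA).1
  · have e2 : (2 : ℤ) • A = -A := by
      rw [eq_neg_iff_add_eq_zero, ← hA3']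
      module
    rw [e2] at hB
    exact hx (hB.inj hA.neg).1

end PointRelations

theorem isSquare_neg_three_mul {K : Type*} [Field K] [CharZero K] {c : K}
    (hc : c ≠ 0) (hs : IsSquare c) :
    IsSquare (-3 * c) ↔ HasOmega K := by
  rw [hasOmega_iff_isSquare]
  refine ⟨fun h => ?_, fun h => h.mul hs⟩
  have := h.div hs
  rwa [mul_div_cancel_right₀ _ hc] at this

/-! ### The subgroup killed by 9. -/

section NineTorsion

variable {K : Type*} [Field K] [CharZero K] [DecidableEq K] {c : K}

/-- If `3`-torsion points off `x = 0` do not all exist, those over `x = 0` generate. -/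
theorem three_torsion_of_isSquare (hc : c ≠ 0) (hs : IsSquare c)
    (h : ¬ IsCube (4 * c) ∨ ¬ HasOmega K) {A : (mordellCurve c).toAffine.Point} {y : K}
    (hA : IsPt A 0 y) {P : (mordellCurve c).toAffine.Point} (hP : 3 • P = 0) :
    ∃ k : ℤ, P = k • A := by
  rcases eq_zero_or_isPt P with rfl | ⟨x, y', hP'⟩
  · exact ⟨0, by simp⟩
  rcases three_nsmul_eq_zero_cases hc hP' hP with ⟨rfl, -⟩ | ⟨hx, hy⟩
  · exact exists_zsmul_of_x_eq hA hP'
  · rcases h with h | h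
    · exact absurd ⟨-x, by linear_combination -hx⟩ h
    · exact absurd ((isSquare_neg_three_mul hc hs).1 ⟨y', by rw [← hy, sq]⟩) h

theorem three_torsion_of_not_isSquare (hc : c ≠ 0) (hs : ¬ IsSquare c) (hω : ¬ HasOmega K)
    {A : (mordellCurve c).toAffine.Point} {x y : K} (hA : IsPt A x y) (hx : x ^ 3 = -4 * c)
    {P : (mordellCurve c).toAffine.Point} (hP : 3 • P = 0) : ∃ k : ℤ, P = k • A := by
  rcases eq_zero_or_isPt P with rfl | ⟨x', y', hP'⟩
  · exact ⟨0, by simp⟩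
  rcases three_nsmul_eq_zero_cases hc hP' hP with ⟨rfl, h⟩ | ⟨hx', -⟩
  · exact absurd ⟨y', by rw [← h, sq]⟩ hs
  · obtain rfl : x' = x := eq_of_pow_three_eq hω (hx'.trans hx.symm)
    exact exists_zsmul_of_x_eq hA hP'

/-- Up to sign, a 3-torsion point Q with x ≠ 0 has the same ordinate e as B. Then either Q = B or Q
- B has abscissa 0, hence is a multiple of A. -/
theorem three_torsion_full (hc : c ≠ 0) {A B : (mordellCurve c).toAffine.Point} {x y e : K}
    (hA : IsPt A 0 y) (hB : IsPt B x e) (hx : x ^ 3 = -4 * c)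
    {P : (mordellCurve c).toAffine.Point} (hP : 3 • P = 0) : ∃ k l : ℤ, P = k • A + l • B := by
  have he : e ^ 2 = -3 * c := by linear_combination hB.eqn + hx
  have key : ∀ Q : (mordellCurve c).toAffine.Point, ∀ x', IsPt Q x' e → x' ^ 3 = -4 * c →
      ∃ k l : ℤ, Q = k • A + l • B := by
    intro Q x' hQ hx'
    by_cases hxx : x' = x
    · subst hxx
      exact ⟨0, 1, by simpa using hQ.eq hB⟩
    · have hsub : x' - x ≠ 0 := sub_ne_zero.2 hxx
      have hq : x' ^ 2 + x' * x + x ^ 2 = 0 :=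
        (mul_eq_zero.1 (show (x' - x) * (x' ^ 2 + x' * x + x ^ 2) = 0 by
          linear_combination hx' - hx)).resolve_left hsub
      have hQB := hQ.add hB.neg hxx (l := 2 * e / (x' - x)) (by field_simp; ring)
      have hX : (2 * e / (x' - x)) ^ 2 - x' - x = 0 := by
        field_simp
        linear_combination 4 * he - hx' - 2 * hx + x * hq
      rw [hX, ← sub_eq_add_neg] at hQB
      obtain ⟨k, hk⟩ := exists_zsmul_of_x_eq hA hQB
      exact ⟨k, 1, by rw [← hk, one_zsmul, sub_add_cancel]⟩
  rcases eq_zero_or_isPt P with rfl | ⟨x', y', hP'⟩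
  · exact ⟨0, 0, by simp⟩
  rcases three_nsmul_eq_zero_cases hc hP' hP with ⟨rfl, -⟩ | ⟨hx', hy'⟩
  · obtain ⟨k, hk⟩ := exists_zsmul_of_x_eq hA hP'
    exact ⟨k, 0, by simpa using hk⟩
  · rcases sq_eq_sq_iff_eq_or_eq_neg.1 (hy'.trans he.symm) with rfl | rfl
    · exact key P x' hP' hx'
    · obtain ⟨k, l, h⟩ := key (-P) x' (by simpa using hP'.neg) hx'
      exact ⟨-k, -l, by rw [neg_zsmul, neg_zsmul, ← neg_add, ← h, neg_neg]⟩

theorem exists_three_torsion_x_zero (hc : c ≠ 0) (hs : IsSquare c) :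
    ∃ (A : (mordellCurve c).toAffine.Point) (y : K), IsPt A 0 y ∧ 3 • A = 0 := by
  obtain ⟨d, hd⟩ := hs
  obtain ⟨A, hA⟩ := exists_isPt (c := c) (x := 0) (y := d) (by norm_num) hc (by rw [hd]; ring)
  exact ⟨A, d, hA, (hA.three_nsmul_eq_zero_iff hc).2 (by simp)⟩

theorem exists_three_torsion_x_ne_zero (hc : c ≠ 0) (h4 : IsCube (4 * c)) (hs : IsSquare (-3 * c)) :
    ∃ (A : (mordellCurve c).toAffine.Point) (x y : K), IsPt A x y ∧ x ^ 3 = -4 * c ∧ x ≠ 0 ∧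
      3 • A = 0 := by
  obtain ⟨e, he⟩ := hs
  obtain ⟨b, hb⟩ := h4
  obtain ⟨A, hA⟩ := exists_isPt (c := c) (x := -b) (y := e) (by norm_num) hc
    (by linear_combination hb - he)
  refine ⟨A, -b, e, hA, by linear_combination -hb, ?_, (hA.three_nsmul_eq_zero_iff hc).2 ?_⟩
  · rw [Ne, neg_eq_zero]
    rintro rfl
    exact hc (by simpa using hb.symm)
  · linear_combination b * hb

theorem exists_nine_torsion (hc : c ≠ 0) (hs : IsSquare c) (h4 : IsCube (4 * c)) (hr : HasR K) :
    ∃ (A : (mordellCurve c).toAffine.Point) (y : K), IsPt (3 • A) 0 y ∧ 9 • A = 0 ∧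
      addOrderOf A = 9 := by
  obtain ⟨d, hd⟩ := hs
  obtain ⟨b, hb⟩ := h4
  obtain ⟨r, hr⟩ := hr
  have hb0 : b ≠ 0 := by
    rintro rfl
    exact hc (by simpa using hb.symm)
  have hr0 : r ≠ 0 := by
    rintro rfl
    norm_num at hr
  -- With b³ = 4c and r³ = 3r² - 1, x³ + c = c(12r² - 3) = c(2r² - 2r - 1)².
  obtain ⟨A, hA⟩ := exists_isPt (c := c) (x := b * r) (y := d * (2 * r ^ 2 - 2 * r - 1))
    (by norm_num) hc (by
      rw [mul_pow b r 3, hb, mul_pow, sq d, ← hd]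
      linear_combination c * (4 * r) * hr)
  have hpoly : (b * r) ^ 9 - 96 * c * (b * r) ^ 6 + 48 * c ^ 2 * (b * r) ^ 3 + 64 * c ^ 3 = 0 := by
    have h3 : (b * r) ^ 3 = 4 * c * (3 * r ^ 2 - 1) := by
      rw [mul_pow, hb]; linear_combination 4 * c * hr
    rw [show (b * r) ^ 9 = ((b * r) ^ 3) ^ 3 by ring, show (b * r) ^ 6 = ((b * r) ^ 3) ^ 2 by ring, h3]
    linear_combination 64 * c ^ 3 * 27 * (r ^ 3 + 3 * r ^ 2 - 1) * hr
  have h3ne : 3 • A ≠ 0 := by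
    rw [Ne, hA.three_nsmul_eq_zero_iff hc]
    have h3 : (b * r) ^ 3 + 4 * c = 4 * c * (3 * r ^ 2) := by
      rw [mul_pow, hb]; linear_combination 4 * c * hr
    rw [h3]
    simp [hb0, hr0, hc]
  obtain ⟨X, Y, hXY⟩ := (eq_zero_or_isPt (3 • A)).resolve_left h3ne
  have hX : X = 0 := by
    have := hA.three_nsmul hc hXY
    rw [hpoly] at this
    refine (mul_eq_zero.1 this).resolve_right ?_
    have := h3ne
    rw [Ne, hA.three_nsmul_eq_zero_iff hc] at this
    have h1 := left_ne_zero_of_mul this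
    have h2 := right_ne_zero_of_mul this
    exact mul_ne_zero (mul_ne_zero (by norm_num) (pow_ne_zero _ h1)) (pow_ne_zero _ h2)
  subst hX
  have h9 : 9 • A = 0 := by
    have := (hXY.three_nsmul_eq_zero_iff hc).2 (by simp)
    rwa [← mul_nsmul] at this
  refine ⟨A, Y, hXY, h9, ?_⟩
  have := Fact.mk Nat.prime_three
  -- The order is 3^(n+1), whence n = 1.
  exact addOrderOf_eq_prime_pow (p := 3) (n := 1) (by simpa using h3ne) (by simpa using h9)

/-- If 3P ≠ 0, then 3P is a 3-torsion point; the hypothesis `hno` rules out the case x(3P) ≠ 0. -/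
theorem three_nsmul_eq_zero_of_nine (hc : c ≠ 0)
    (hno : ∀ r w : K, r ^ 3 - 3 * r ^ 2 + 1 = 0 → w ^ 3 + 3 * r * w ^ 2 + 1 ≠ 0)
    {P : (mordellCurve c).toAffine.Point} (h9 : 9 • P = 0) :
    3 • P = 0 ∨ ((∃ y, IsPt (3 • P) 0 y) ∧ IsSquare c ∧ IsCube (4 * c) ∧ HasR K) := by
  rcases eq_zero_or_isPt (3 • P) with h0 | ⟨X, Y, hXY⟩
  · exact .inl h0
  have hP0 : P ≠ 0 := by
    rintro rfl
    exact hXY.ne_zero (by simp)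
  obtain ⟨x, y, hP⟩ := (eq_zero_or_isPt P).resolve_left hP0
  rcases three_nsmul_eq_zero_cases hc hXY (by rw [← mul_nsmul]; exact h9) with ⟨rfl, -⟩ | ⟨hX, -⟩
  · exact .inr ⟨⟨Y, hXY⟩, exists_root_of_three_nsmul_x_eq_zero hc hP hXY⟩
  · obtain ⟨r, w, hr, hw⟩ := exists_root_of_three_nsmul_x_ne_zero hc hP hXY hX
    exact absurd hw (hno r w hr)

theorem nine_torsion_trivial (hc : c ≠ 0)
    (hno : ∀ r w : K, r ^ 3 - 3 * r ^ 2 + 1 = 0 → w ^ 3 + 3 * r * w ^ 2 + 1 ≠ 0)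
    (hs : ¬ IsSquare c)
    (h : HasOmega K ∨ ¬ IsCube (4 * c) ∨ ¬ IsSquare (-3 * c)) :
    Nonempty (killedBy (mordellCurve c).toAffine.Point 9 ≃+ ZMod 1) := by
  refine equiv_zmod_one fun P hP => ?_
  have h3 := (three_nsmul_eq_zero_of_nine hc hno hP).resolve_right fun h => hs h.2.1
  rcases eq_zero_or_isPt P with h0 | ⟨x, y, hxy⟩
  · exact h0
  rcases three_nsmul_eq_zero_cases hc hxy h3 with ⟨-, h'⟩ | ⟨hx, hy⟩
  · exact absurd ⟨y, by rw [← h', sq]⟩ hs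
  · have h1 : IsCube (4 * c) := ⟨-x, by linear_combination -hx⟩
    have h2 : IsSquare (-3 * c) := ⟨y, by rw [← hy, sq]⟩
    rcases h with h | h | h
    · refine absurd ?_ hs
      have := h2.div (hasOmega_iff_isSquare.1 h)
      rwa [mul_div_cancel_left₀ _ (by norm_num)] at this
    · exact absurd h1 h
    · exact absurd h2 h

theorem nine_torsion_three_of_isSquare (hc : c ≠ 0)
    (hno : ∀ r w : K, r ^ 3 - 3 * r ^ 2 + 1 = 0 → w ^ 3 + 3 * r * w ^ 2 + 1 ≠ 0)
    (hs : IsSquare c) (h : ¬ IsCube (4 * c) ∨ ¬ HasOmega K)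
    (hr : ¬ (IsCube (4 * c) ∧ HasR K)) :
    Nonempty (killedBy (mordellCurve c).toAffine.Point 9 ≃+ ZMod 3) := by
  obtain ⟨A, y, hA, hA3⟩ := exists_three_torsion_x_zero hc hs
  refine equiv_zmod (a := A) ?_ (addOrderOf_eq_three hA3 hA.ne_zero) fun P hP => ?_
  · rw [mem_killedBy, show 9 = 3 * 3 from rfl, mul_nsmul, hA3, nsmul_zero]
  · exact three_torsion_of_isSquare hc hs h hA
      ((three_nsmul_eq_zero_of_nine hc hno hP).resolve_right fun h => hr h.2.2)

theorem nine_torsion_three_of_not_isSquare (hc : c ≠ 0)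
    (hno : ∀ r w : K, r ^ 3 - 3 * r ^ 2 + 1 = 0 → w ^ 3 + 3 * r * w ^ 2 + 1 ≠ 0)
    (hs : ¬ IsSquare c) (hω : ¬ HasOmega K)
    (h4 : IsCube (4 * c)) (h3 : IsSquare (-3 * c)) :
    Nonempty (killedBy (mordellCurve c).toAffine.Point 9 ≃+ ZMod 3) := by
  obtain ⟨A, x, y, hA, hx, -, hA3⟩ := exists_three_torsion_x_ne_zero hc h4 h3
  refine equiv_zmod (a := A) ?_ (addOrderOf_eq_three hA3 hA.ne_zero) fun P hP => ?_
  · rw [mem_killedBy, show 9 = 3 * 3 from rfl, mul_nsmul, hA3, nsmul_zero]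
  · exact three_torsion_of_not_isSquare hc hs hω hA hx
      ((three_nsmul_eq_zero_of_nine hc hno hP).resolve_right fun h => hs h.2.1)

theorem nine_torsion_three_three (hc : c ≠ 0)
    (hno : ∀ r w : K, r ^ 3 - 3 * r ^ 2 + 1 = 0 → w ^ 3 + 3 * r * w ^ 2 + 1 ≠ 0)
    (hs : IsSquare c) (h4 : IsCube (4 * c)) (hω : HasOmega K)
    (hr : ¬ HasR K) :
    Nonempty (killedBy (mordellCurve c).toAffine.Point 9 ≃+ ZMod 3 × ZMod 3) := by
  obtain ⟨A, y, hA, hA3⟩ := exists_three_torsion_x_zero hc hs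
  obtain ⟨B, x, e, hB, hx, hx0, hB3⟩ := exists_three_torsion_x_ne_zero hc h4
    ((isSquare_neg_three_mul hc hs).2 hω)
  refine equiv_zmod_prod_prime (a := A) (b := B) Nat.prime_three ?_ ?_
    (addOrderOf_eq_three hA3 hA.ne_zero) hB3 ?_ fun P hP => ?_
  · rw [mem_killedBy, show 9 = 3 * 3 from rfl, mul_nsmul, hA3, nsmul_zero]
  · rw [mem_killedBy, show 9 = 3 * 3 from rfl, mul_nsmul, hB3, nsmul_zero]
  · exact not_mem_zmultiples_of_x hA hB hx0 hA3
  · exact three_torsion_full hc hA hB hx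
      ((three_nsmul_eq_zero_of_nine hc hno hP).resolve_right fun h => hr h.2.2.2)

theorem nine_torsion_nine (hc : c ≠ 0)
    (hno : ∀ r w : K, r ^ 3 - 3 * r ^ 2 + 1 = 0 → w ^ 3 + 3 * r * w ^ 2 + 1 ≠ 0)
    (hs : IsSquare c) (h4 : IsCube (4 * c)) (hω : ¬ HasOmega K)
    (hr : HasR K) :
    Nonempty (killedBy (mordellCurve c).toAffine.Point 9 ≃+ ZMod 9) := by
  obtain ⟨A, y, hA3, hA9, hA⟩ := exists_nine_torsion hc hs h4 hr
  refine equiv_zmod (a := A) hA9 hA fun P hP => ?_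
  -- 3P is a multiple k(3A), so P - kA is 3-torsion and hence itself a multiple of 3A.
  obtain ⟨k, hk⟩ : ∃ k : ℤ, 3 • P = k • (3 • A) := by
    rcases three_nsmul_eq_zero_of_nine hc hno hP with h | ⟨⟨y', h⟩, -⟩
    · exact ⟨0, by simpa using h⟩
    · exact exists_zsmul_of_x_eq hA3 h
  obtain ⟨l, hl⟩ := three_torsion_of_isSquare hc hs (.inr hω) hA3 (P := P - k • A)
    (by rw [nsmul_sub, hk, smul_comm, sub_self])
  refine ⟨k + l * 3, ?_⟩
  rw [add_zsmul, mul_zsmul, ← sub_eq_iff_eq_add', hl]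
  rfl

theorem nine_torsion_nine_three (hc : c ≠ 0)
    (hno : ∀ r w : K, r ^ 3 - 3 * r ^ 2 + 1 = 0 → w ^ 3 + 3 * r * w ^ 2 + 1 ≠ 0)
    (hs : IsSquare c) (h4 : IsCube (4 * c)) (hω : HasOmega K)
    (hr : HasR K) :
    Nonempty (killedBy (mordellCurve c).toAffine.Point 9 ≃+ ZMod 9 × ZMod 3) := by
  obtain ⟨A, y, hA3, hA9, hA⟩ := exists_nine_torsion hc hs h4 hr
  obtain ⟨B, x, e, hB, hx, hx0, hB3⟩ := exists_three_torsion_x_ne_zero hc h4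
    ((isSquare_neg_three_mul hc hs).2 hω)
  refine equiv_zmod_prod_prime (a := A) (b := B) Nat.prime_three hA9 ?_ hA hB3 ?_ fun P hP => ?_
  · rw [mem_killedBy, show 9 = 3 * 3 from rfl, mul_nsmul, hB3, nsmul_zero]
  · intro h
    obtain ⟨k, rfl⟩ := AddSubgroup.mem_zmultiples_iff.1 h
    -- If B = kA, then 3B = 0 forces 3 ∣ k, so B would be a multiple of 3A, whose nonzero multiples
    -- have x = 0.
    have h9 : (9 : ℤ) ∣ 3 * k := by
      have : ((addOrderOf A : ℕ) : ℤ) ∣ 3 * k := by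
        rw [addOrderOf_dvd_iff_zsmul_eq_zero, mul_comm, mul_zsmul']
        exact (natCast_zsmul _ 3).trans hB3
      rwa [hA] at this
    obtain ⟨m, rfl⟩ : (3 : ℤ) ∣ k := by omega
    refine not_mem_zmultiples_of_x hA3 hB hx0 (by rw [← mul_nsmul]; exact hA9)
      (AddSubgroup.mem_zmultiples_iff.2 ⟨m, ?_⟩)
    rw [mul_comm, mul_zsmul]
    rfl
  · obtain ⟨k, hk⟩ : ∃ k : ℤ, 3 • P = k • (3 • A) := by
      rcases three_nsmul_eq_zero_of_nine hc hno hP with h | ⟨⟨y', h⟩, -⟩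
      · exact ⟨0, by simpa using h⟩
      · exact exists_zsmul_of_x_eq hA3 h
    obtain ⟨l, m, hl⟩ := three_torsion_full hc hA3 hB hx (P := P - k • A)
      (by rw [nsmul_sub, hk, smul_comm, sub_self])
    refine ⟨k + l * 3, m, ?_⟩
    rw [add_zsmul, mul_zsmul, add_assoc, ← sub_eq_iff_eq_add', hl]
    rfl

end NineTorsion

/-! ### Cubic subfields and coordinates in them. -/

section CubicSubfields

open Polynomial IntermediateField

theorem exists_int_of_root {p : ℤ[X]} (hp : p.Monic) {a : ℚ} (h : aeval a p = 0) :
    ∃ m : ℤ, aeval m p = 0 := by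
  obtain ⟨m, hm⟩ := isInteger_of_is_root_of_monic hp h
  refine ⟨m, ?_⟩
  rw [← hm] at h
  rw [aeval_algebraMap_apply] at h
  simpa using h

theorem pow_three_ne_of_mod {n : ℤ} (h : ∀ m : ℤ, m ^ 3 ≠ n) (a : ℚ) : a ^ 3 ≠ n := by
  intro ha
  obtain ⟨m, hm⟩ := exists_int_of_root (p := X ^ 3 - C n) (monic_X_pow_sub_C n (by norm_num))
    (a := a) (by simp [ha])
  exact h m (by simpa [sub_eq_zero] using hm)

theorem int_pow_three_ne {n k : ℤ} (h : ∀ x : ZMod 7, x ^ 3 ≠ (n : ZMod 7)) : k ^ 3 ≠ n := by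
  rintro rfl
  exact h k (by simp)

/-- Needed for 6, which is -1 and so a cube modulo 7, but not a cube modulo 9. -/
theorem int_pow_three_ne' {n k : ℤ} (h : ∀ x : ZMod 9, x ^ 3 ≠ (n : ZMod 9)) : k ^ 3 ≠ n := by
  rintro rfl
  exact h k (by simp)

theorem rat_pow_three_ne_two (a : ℚ) : a ^ 3 ≠ 2 := by
  exact_mod_cast pow_three_ne_of_mod (n := 2) (fun m => int_pow_three_ne (by decide)) a

theorem rat_pow_three_ne_three (a : ℚ) : a ^ 3 ≠ 3 := by
  exact_mod_cast pow_three_ne_of_mod (n := 3) (fun m => int_pow_three_ne (by decide)) a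

theorem rat_pow_three_ne_six (a : ℚ) : a ^ 3 ≠ 6 := by
  exact_mod_cast pow_three_ne_of_mod (n := 6) (fun m => int_pow_three_ne' (by decide)) a

theorem rat_pow_three_ne_eighteen (a : ℚ) : a ^ 3 ≠ 18 := by
  exact_mod_cast pow_three_ne_of_mod (n := 18) (fun m => int_pow_three_ne (by decide)) a

/-- The polynomial `X³ - 3X² + 1`. -/
noncomputable def rPoly : ℚ[X] := X ^ 3 - C 3 * X ^ 2 + 1

theorem rPoly_natDegree : rPoly.natDegree = 3 := by
  unfold rPoly
  compute_degree!

theorem rPoly_monic : rPoly.Monic := by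
  unfold rPoly
  monicity!

theorem rPoly_irreducible : Irreducible rPoly := by
  rw [rPoly_monic.irreducible_iff_roots_eq_zero_of_degree_le_three (by rw [rPoly_natDegree]; norm_num)
    (by rw [rPoly_natDegree]), Multiset.eq_zero_iff_forall_notMem]
  intro a ha
  have ha' : a ^ 3 - 3 * a ^ 2 + 1 = 0 := by
    simpa [rPoly] using isRoot_of_mem_roots ha
  obtain ⟨m, hm⟩ := exists_int_of_root (p := X ^ 3 - C 3 * X ^ 2 + 1) (by monicity!) (a := a)
    (by
      simp only [map_add, map_sub, map_mul, map_pow, aeval_X, aeval_C, map_one]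
      simpa using ha')
  have hm' : m ^ 3 - 3 * m ^ 2 + 1 = 0 := by simpa using hm
  have h2 : ∀ x : ZMod 2, x ^ 3 - 3 * x ^ 2 + 1 ≠ 0 := by decide
  exact h2 m (by exact_mod_cast congrArg (Int.cast (R := ZMod 2)) hm')

theorem X_pow_three_sub_irreducible {n : ℚ} (h : ∀ a : ℚ, a ^ 3 ≠ n) :
    Irreducible (X ^ 3 - C n : ℚ[X]) := by
  rw [(monic_X_pow_sub_C n (by norm_num)).irreducible_iff_roots_eq_zero_of_degree_le_three
    (by simp) (by simp), Multiset.eq_zero_iff_forall_notMem]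
  intro a ha
  exact h a (by simpa [sub_eq_zero] using isRoot_of_mem_roots ha)

variable {K : Type*} [Field K] [CharZero K]

theorem minpoly_of_rPoly {r : K} (hr : r ^ 3 - 3 * r ^ 2 + 1 = 0) :
    (minpoly ℚ r).natDegree = 3 := by
  rw [← minpoly.eq_of_irreducible_of_monic rPoly_irreducible (by simpa [rPoly] using hr) rPoly_monic,
    rPoly_natDegree]

theorem minpoly_of_pow_three {n : ℚ} (h : ∀ a : ℚ, a ^ 3 ≠ n) {t : K} (ht : t ^ 3 = n) :
    (minpoly ℚ t).natDegree = 3 := by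
  rw [← minpoly.eq_of_irreducible_of_monic (X_pow_three_sub_irreducible h) (by simp [ht])
    (monic_X_pow_sub_C n (by norm_num)), natDegree_X_pow_sub_C]

theorem eq_zero_of_quadratic_eq_zero {r : K} (hr : (minpoly ℚ r).natDegree = 3) {a b c : ℚ}
    (h : (a : K) + b * r + c * r ^ 2 = 0) : a = 0 ∧ b = 0 ∧ c = 0 := by
  have hq : (C c * X ^ 2 + C b * X + C a : ℚ[X]) = 0 := by
    by_contra hne
    have h1 := natDegree_le_of_dvd (minpoly.dvd ℚ r (p := C c * X ^ 2 + C b * X + C a) (by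
      simp only [map_add, map_mul, map_pow, aeval_X, aeval_C, eq_ratCast]
      linear_combination h)) hne
    have h2 : (C c * X ^ 2 + C b * X + C a : ℚ[X]).natDegree ≤ 2 := natDegree_quadratic_le
    omega
  refine ⟨?_, ?_, ?_⟩
  · simpa using congrArg (fun p => p.coeff 0) hq
  · simpa [coeff_X, coeff_C] using congrArg (fun p => p.coeff 1) hq
  · simpa [coeff_X, coeff_C] using congrArg (fun p => p.coeff 2) hq

theorem exists_quadratic_of_mem_adjoin {r : K} (hr : (minpoly ℚ r).natDegree = 3) {z : K}
    (hz : z ∈ ℚ⟮r⟯) : ∃ a b c : ℚ, z = a + b * r + c * r ^ 2 := by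
  have hint : IsIntegral ℚ r := by
    by_contra h
    rw [minpoly.eq_zero h] at hr
    simp at hr
  obtain ⟨f, hf, hfz⟩ := (adjoin.powerBasis hint).exists_eq_aeval ⟨z, hz⟩
  rw [adjoin.powerBasis_dim, hr] at hf
  rw [aeval_eq_sum_range' hf] at hfz
  refine ⟨f.coeff 0, f.coeff 1, f.coeff 2, ?_⟩
  have := congrArg (algebraMap ℚ⟮r⟯ K) hfz
  simpa [Finset.sum_range_succ, adjoin.powerBasis_gen, Algebra.smul_def] using this

variable [FiniteDimensional ℚ K]

/-- A monic cubic over a cubic subfield that has a root in a field of degree prime to nine has a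
root in the subfield. -/
theorem exists_root_mem_adjoin (hK : ¬ 9 ∣ Module.finrank ℚ K) {r : K}
    (hr : (minpoly ℚ r).natDegree = 3) {p : ℚ⟮r⟯[X]} (hp : p.Monic) (hp3 : p.natDegree = 3) {w : K}
    (hw : aeval w p = 0) : ∃ z : ℚ⟮r⟯, p.IsRoot z := by
  by_contra! hno
  -- A cubic without roots is irreducible, so K would contain an extension of degree 9 of ℚ.
  have hirr : Irreducible p := by
    rw [hp.irreducible_iff_roots_eq_zero_of_degree_le_three (by omega) (by omega),
      Multiset.eq_zero_iff_forall_notMem]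
    exact fun a ha => hno a (isRoot_of_mem_roots ha)
  have h1 : 3 ∣ Module.finrank ℚ⟮r⟯ K := by
    rw [← hp3, minpoly.eq_of_irreducible_of_monic hirr hw hp]
    exact minpoly.degree_dvd (Algebra.IsIntegral.isIntegral w)
  have h2 : Module.finrank ℚ ℚ⟮r⟯ = 3 := by
    rw [adjoin.finrank (Algebra.IsIntegral.isIntegral r), hr]
  rw [← Module.finrank_mul_finrank ℚ ℚ⟮r⟯ K, h2] at hK
  exact hK (mul_dvd_mul_left 3 h1)

end CubicSubfields

/-! ### Descent at 19 in the cubic field ℚ(r). -/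

section ConductorNine

variable {K : Type*} [Field K] [CharZero K]

/-- X³ - 3X² + 1 has the distinct roots 11, 13, 17 modulo 19; the coefficients below invert the
corresponding Vandermonde matrix. -/
theorem eq_zero_mod_nineteen (A B C : ZMod 19)
    (h : ∀ r : ZMod 19, r ^ 3 - 3 * r ^ 2 + 1 = 0 → A + B * r + C * r ^ 2 = 0) :
    A = 0 ∧ B = 0 ∧ C = 0 := by
  have h11 := h 11 (by decide)
  have h13 := h 13 (by decide)
  have h17 := h 17 (by decide)
  have h19 : (19 : ZMod 19) = 0 := by decide
  refine ⟨?_, ?_, ?_⟩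
  · linear_combination h11 + 17 * h13 + 2 * h17 - (A + 14 * B + 188 * C) * h19
  · linear_combination 7 * h11 + 13 * h13 + 18 * h17 - (2 * A + 29 * B + 434 * C) * h19
  · linear_combination 8 * h11 + 7 * h13 + 4 * h17 - (A + 13 * B + 174 * C) * h19

/-- Descent modulo `19` for the equation `w³ + 3grw² + m = 0` in `ℚ(r)`. -/
theorem no_root_of_mod_nineteen {r : K} (hr : r ^ 3 - 3 * r ^ 2 + 1 = 0) {g m : ℤ}
    (h19 : ∀ r : ZMod 19, r ^ 3 - 3 * r ^ 2 + 1 = 0 → ∀ x D : ZMod 19,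
      x ^ 3 + 3 * g * r * x ^ 2 * D + m * D ^ 3 = 0 → x = 0 ∧ D = 0)
    (N : ℕ) (A B C D : ℤ) (hN : D.natAbs = N)
    (h : ((A : K) + B * r + C * r ^ 2) ^ 3 + 3 * g * r * (A + B * r + C * r ^ 2) ^ 2 * D +
      m * D ^ 3 = 0) : D = 0 := by
  induction N using Nat.strong_induction_on generalizing A B C D with
  | _ N ih =>
  by_contra hD
  -- u0, u1, u2 are the coordinates of (A + Br + Cr²)² in the basis 1, r, r², reduced by r³ = 3r² -
  -- 1.
  obtain ⟨u0, hu0⟩ : ∃ u, u = A ^ 2 - 2 * B * C - 3 * C ^ 2 := ⟨_, rfl⟩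
  obtain ⟨u1, hu1⟩ : ∃ u, u = 2 * A * B - C ^ 2 := ⟨_, rfl⟩
  obtain ⟨u2, hu2⟩ : ∃ u, u = B ^ 2 + 2 * A * C + 6 * B * C + 9 * C ^ 2 := ⟨_, rfl⟩
  obtain ⟨e0, e1, e2⟩ := eq_zero_of_quadratic_eq_zero (minpoly_of_rPoly hr)
    (a := ((u0 * A - (u1 * C + u2 * B) - 3 * u2 * C - 3 * g * D * u2 + m * D ^ 3 : ℤ) : ℚ))
    (b := ((u0 * B + u1 * A - u2 * C + 3 * g * D * u0 : ℤ) : ℚ))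
    (c := ((u0 * C + u1 * B + u2 * A + 3 * (u1 * C + u2 * B) + 9 * u2 * C +
      3 * g * D * (u1 + 3 * u2) : ℤ) : ℚ)) (by
      simp only [Rat.cast_intCast]
      push_cast [hu0, hu1, hu2]
      linear_combination h - ((A + B * r + C * r ^ 2) * (2 * B * C + C ^ 2 * (r + 3)) +
        ((2 * A * B - C ^ 2) * C + (B ^ 2 + 2 * A * C + 6 * B * C + 9 * C ^ 2) * B +
          (B ^ 2 + 2 * A * C + 6 * B * C + 9 * C ^ 2) * C * (r + 3)) +
        3 * g * D * (r * (2 * B * C + C ^ 2 * (r + 3)) +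
          (B ^ 2 + 2 * A * C + 6 * B * C + 9 * C ^ 2))) * hr)
  rw [Int.cast_eq_zero] at e0 e1 e2
  have c0 := congrArg (Int.cast (R := ZMod 19)) e0
  have c1 := congrArg (Int.cast (R := ZMod 19)) e1
  have c2 := congrArg (Int.cast (R := ZMod 19)) e2
  push_cast [hu0, hu1, hu2] at c0 c1 c2
  -- The three coordinates of the equation vanish, so it also holds modulo 19 with r replaced by any
  -- root s there.
  have key : ∀ s : ZMod 19, s ^ 3 - 3 * s ^ 2 + 1 = 0 →
      (A : ZMod 19) + B * s + C * s ^ 2 = 0 ∧ (D : ZMod 19) = 0 := by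
    intro s hs
    refine h19 s hs _ _ ?_
    linear_combination c0 + s * c1 + s ^ 2 * c2 +
      ((A + B * s + C * s ^ 2) * (2 * B * C + C ^ 2 * (s + 3)) +
        ((2 * A * B - C ^ 2) * C + (B ^ 2 + 2 * A * C + 6 * B * C + 9 * C ^ 2) * B +
          (B ^ 2 + 2 * A * C + 6 * B * C + 9 * C ^ 2) * C * (s + 3)) +
        3 * g * D * (s * (2 * B * C + C ^ 2 * (s + 3)) +
          (B ^ 2 + 2 * A * C + 6 * B * C + 9 * C ^ 2))) * hs
  obtain ⟨hA, hB, hC⟩ := eq_zero_mod_nineteen A B C fun s hs => (key s hs).1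
  have hD0 : (D : ZMod 19) = 0 := by
    obtain ⟨s, hs⟩ : ∃ s : ZMod 19, s ^ 3 - 3 * s ^ 2 + 1 = 0 := ⟨11, by decide⟩
    exact (key s hs).2
  rw [ZMod.intCast_zmod_eq_zero_iff_dvd] at hA hB hC hD0
  obtain ⟨A, rfl⟩ := hA
  obtain ⟨B, rfl⟩ := hB
  obtain ⟨C, rfl⟩ := hC
  obtain ⟨D, rfl⟩ := hD0
  have hD' : D ≠ 0 := by
    rintro rfl
    simp at hD
  -- A, B, C, D are all divisible by 19. The equation is homogeneous, so the quotients satisfy it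
  -- with a smaller nonzero |D|.
  refine hD' (ih D.natAbs ?_ A B C D rfl ?_)
  · rw [← hN, Int.natAbs_mul]
    have : 0 < D.natAbs := Int.natAbs_pos.2 hD'
    norm_num
    omega
  · push_cast at h
    have h' : (19 : K) ^ 3 * (((A : K) + B * r + C * r ^ 2) ^ 3 +
        3 * g * r * (A + B * r + C * r ^ 2) ^ 2 * D + m * D ^ 3) = 0 := by
      linear_combination h
    exact (mul_eq_zero.1 h').resolve_left (by norm_num)

open Polynomial IntermediateField in
-- A root in K yields one in ℚ(r), whose cleared denominator D would have to vanish. The values g =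
-- m = 1 exclude points of order 9 off x = 0; g = 0 shows that 2 and 3 are not cubes.
theorem no_root_of_hasR [FiniteDimensional ℚ K] (hK : ¬ 9 ∣ Module.finrank ℚ K) {g m : ℤ}
    (h19 : ∀ r : ZMod 19, r ^ 3 - 3 * r ^ 2 + 1 = 0 → ∀ x D : ZMod 19,
      x ^ 3 + 3 * g * r * x ^ 2 * D + m * D ^ 3 = 0 → x = 0 ∧ D = 0)
    (r w : K) (hr : r ^ 3 - 3 * r ^ 2 + 1 = 0) : w ^ 3 + 3 * g * r * w ^ 2 + m ≠ 0 := by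
  intro hw
  have h3 : ((3 : ℚ⟮r⟯) : K) = 3 := rfl
  let ρ : ℚ⟮r⟯ := AdjoinSimple.gen ℚ r
  obtain ⟨z, hz⟩ := exists_root_mem_adjoin hK (minpoly_of_rPoly hr)
    (p := X ^ 3 + C (3 * (g : ℚ⟮r⟯) * ρ) * X ^ 2 + C (m : ℚ⟮r⟯)) (by monicity!) (by compute_degree!)
    (w := w) (by simpa [ρ, h3] using hw)
  have hz' : (z : K) ^ 3 + 3 * g * r * (z : K) ^ 2 + m = 0 := by
    simpa [ρ, h3] using congrArg (algebraMap ℚ⟮r⟯ K) hz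
  obtain ⟨a, b, c, habc⟩ := exists_quadratic_of_mem_adjoin (minpoly_of_rPoly hr) z.2
  have hD := no_root_of_mod_nineteen hr h19 _ (a.num * b.den * c.den) (b.num * a.den * c.den)
    (c.num * a.den * b.den) (a.den * b.den * c.den) rfl (by
      have ha : (a.num : K) = a * a.den := by exact_mod_cast (Rat.mul_den_eq_num a).symm
      have hb : (b.num : K) = b * b.den := by exact_mod_cast (Rat.mul_den_eq_num b).symm
      have hc : (c.num : K) = c * c.den := by exact_mod_cast (Rat.mul_den_eq_num c).symm
      push_cast
      rw [ha, hb, hc]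
      rw [habc] at hz'
      linear_combination ((a.den : K) * b.den * c.den) ^ 3 * hz')
  simp at hD

theorem no_nine_division [FiniteDimensional ℚ K] (hK : ¬ 9 ∣ Module.finrank ℚ K) (r w : K)
    (hr : r ^ 3 - 3 * r ^ 2 + 1 = 0) : w ^ 3 + 3 * r * w ^ 2 + 1 ≠ 0 := by
  have := no_root_of_hasR hK (g := 1) (m := 1) (by decide +kernel) r w hr
  simpa using this

theorem not_isCube_two_of_hasR [FiniteDimensional ℚ K] (hK : ¬ 9 ∣ Module.finrank ℚ K)
    (hr : HasR K) : ¬ IsCube (2 : K) := by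
  obtain ⟨r, hr⟩ := hr
  rintro ⟨t, ht⟩
  have := no_root_of_hasR hK (g := 0) (m := -2) (by decide +kernel) r t hr
  simp [ht] at this

theorem not_isCube_three_of_hasR [FiniteDimensional ℚ K] (hK : ¬ 9 ∣ Module.finrank ℚ K)
    (hr : HasR K) : ¬ IsCube (3 : K) := by
  obtain ⟨r, hr⟩ := hr
  rintro ⟨t, ht⟩
  have := no_root_of_hasR hK (g := 0) (m := -3) (by decide +kernel) r t hr
  simp [ht] at this

end ConductorNine

/-! ### From the arithmetic conditions to the torsion group. -/

section Classification

variable {K : Type*} [Field K]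

theorem IsCube.mul {a b : K} (ha : IsCube a) (hb : IsCube b) : IsCube (a * b) := by
  obtain ⟨x, rfl⟩ := ha
  obtain ⟨y, rfl⟩ := hb
  exact ⟨x * y, mul_pow x y 3⟩

theorem IsCube.div {a b : K} (ha : IsCube a) (hb : IsCube b) : IsCube (a / b) := by
  obtain ⟨x, rfl⟩ := ha
  obtain ⟨y, rfl⟩ := hb
  exact ⟨x / y, div_pow x y 3⟩

theorem isCube_four_iff [CharZero K] : IsCube (4 : K) ↔ IsCube (2 : K) := by
  have h8 : IsCube (8 : K) := ⟨2, by norm_num⟩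
  constructor
  · intro h
    have := h8.div h
    rwa [show (8 : K) / 4 = 2 by norm_num] at this
  · intro h
    have := h.mul h
    rwa [show (2 : K) * 2 = 4 by norm_num] at this

theorem isCube_four_mul_iff {c : K} (hc : c ≠ 0) (hcub : IsCube c) :
    IsCube (4 * c) ↔ IsCube (4 : K) := by
  refine ⟨fun h => ?_, fun h => h.mul hcub⟩
  have := h.div hcub
  rwa [mul_div_cancel_right₀ _ hc] at this

theorem not_isCube_four_of_hasR [NumberField K]
    (hK : Module.finrank ℚ K = 3 ∨ Module.finrank ℚ K = 6) (hr : HasR K) : ¬ IsCube (4 : K) := by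
  rw [isCube_four_iff]
  exact not_isCube_two_of_hasR (by omega) hr

theorem mordellTorsionIso_of_equiv [NumberField K]
    (hK : Module.finrank ℚ K = 3 ∨ Module.finrank ℚ K = 6) {c : ℚ} (hc : c ≠ 0)
    {A B G : Type*} [AddCommGroup A] [AddCommGroup B] [AddCommGroup G]
    (h2 : ∀ [DecidableEq K], Nonempty (killedBy (mordellCurve (c : K)).toAffine.Point 2 ≃+ A))
    (h9 : ∀ [DecidableEq K], Nonempty (killedBy (mordellCurve (c : K)).toAffine.Point 9 ≃+ B))
    (e : A × B ≃+ G) : MordellTorsionIso K (c : K) G := by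
  classical
  obtain ⟨e0⟩ := torsion_equiv_prod (G := (mordellCurve (c : K)).toAffine.Point)
    fun g hg => nsmul_eighteen_eq_zero hK hc hg
  obtain ⟨e2⟩ := h2
  obtain ⟨e9⟩ := h9
  exact ⟨e0.trans ((e2.prodCongr e9).trans e)⟩

/-- `ℤ/2 ⊕ ℤ/3 ≃ ℤ/6`. -/
def zmodTwoProdThree : ZMod 2 × ZMod 3 ≃+ ZMod 6 :=
  (ZMod.chineseRemainder (m := 2) (n := 3) (by norm_num)).symm.toAddEquiv

variable [NumberField K]

theorem torsion_of_cond9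
    (hK : Module.finrank ℚ K = 3 ∨ Module.finrank ℚ K = 6) {c : ℚ} (hc : c ≠ 0) (h : Cond9 K (c : K)) : MordellTorsionIso K (c : K) (ZMod 9) := by
  have hc' : (c : K) ≠ 0 := by exact_mod_cast hc
  obtain ⟨hs, h4, hω, hr⟩ := h
  refine mordellTorsionIso_of_equiv hK hc (two_torsion_trivial fun hcub => ?_)
    (nine_torsion_nine hc' (no_nine_division (by omega)) hs h4 hω hr) AddEquiv.uniqueProd
  exact not_isCube_four_of_hasR hK hr ((isCube_four_mul_iff hc' hcub).1 h4)

theorem torsion_of_cond6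
    (hK : Module.finrank ℚ K = 3 ∨ Module.finrank ℚ K = 6) {c : ℚ} (hc : c ≠ 0) (h : Cond6 K (c : K)) : MordellTorsionIso K (c : K) (ZMod 6) := by
  have hc' : (c : K) ≠ 0 := by exact_mod_cast hc
  rcases h with ⟨hs, hcub, hω⟩ | ⟨hcub, h4, h3, hω⟩
  · refine mordellTorsionIso_of_equiv hK hc (two_torsion_cyclic hc' hcub hω)
      (nine_torsion_three_of_isSquare hc' (no_nine_division (by omega)) hs (.inr hω) ?_)
      zmodTwoProdThree
    exact fun h => not_isCube_four_of_hasR hK h.2 ((isCube_four_mul_iff hc' hcub).1 h.1)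
  · refine mordellTorsionIso_of_equiv hK hc (two_torsion_cyclic hc' hcub hω)
      (nine_torsion_three_of_not_isSquare hc' (no_nine_division (by omega)) (fun hs => ?_) hω
        (h4.mul hcub) h3) zmodTwoProdThree
    exact hω ((isSquare_neg_three_mul hc' hs).1 h3)

theorem torsion_of_cond3
    (hK : Module.finrank ℚ K = 3 ∨ Module.finrank ℚ K = 6) {c : ℚ} (hc : c ≠ 0) (h : Cond3 K (c : K)) : MordellTorsionIso K (c : K) (ZMod 3) := by
  have hc' : (c : K) ≠ 0 := by exact_mod_cast hc
  rcases h with ⟨hs, hcub, h4⟩ | ⟨hs, hcub, h4, hω, hr⟩ | ⟨hcub, h4, h3, hω⟩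
  · exact mordellTorsionIso_of_equiv hK hc (two_torsion_trivial hcub)
      (nine_torsion_three_of_isSquare hc' (no_nine_division (by omega)) hs (.inl h4)
        fun h => h4 h.1) AddEquiv.uniqueProd
  · exact mordellTorsionIso_of_equiv hK hc (two_torsion_trivial hcub)
      (nine_torsion_three_of_isSquare hc' (no_nine_division (by omega)) hs (.inr hω)
        fun h => hr h.2) AddEquiv.uniqueProd
  · refine mordellTorsionIso_of_equiv hK hc (two_torsion_trivial hcub)
      (nine_torsion_three_of_not_isSquare hc' (no_nine_division (by omega)) (fun hs => ?_) hω h4 h3)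
      AddEquiv.uniqueProd
    exact hω ((isSquare_neg_three_mul hc' hs).1 h3)

theorem torsion_of_cond2
    (hK : Module.finrank ℚ K = 3 ∨ Module.finrank ℚ K = 6) {c : ℚ} (hc : c ≠ 0) (h : Cond2 K (c : K)) : MordellTorsionIso K (c : K) (ZMod 2) := by
  have hc' : (c : K) ≠ 0 := by exact_mod_cast hc
  rcases h with ⟨hcub, hs, h4, hω⟩ | ⟨hcub, hs, h3, hω⟩
  · exact mordellTorsionIso_of_equiv hK hc (two_torsion_cyclic hc' hcub hω)
      (nine_torsion_trivial hc' (no_nine_division (by omega)) hs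
        (.inr (.inl (by rwa [isCube_four_mul_iff hc' hcub])))) AddEquiv.prodUnique
  · exact mordellTorsionIso_of_equiv hK hc (two_torsion_cyclic hc' hcub hω)
      (nine_torsion_trivial hc' (no_nine_division (by omega)) hs (.inr (.inr h3)))
      AddEquiv.prodUnique

theorem torsion_of_cond93
    (hK : Module.finrank ℚ K = 3 ∨ Module.finrank ℚ K = 6) {c : ℚ} (hc : c ≠ 0) (h : Cond93 K (c : K)) :
    MordellTorsionIso K (c : K) (ZMod 9 × ZMod 3) := by
  have hc' : (c : K) ≠ 0 := by exact_mod_cast hc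
  obtain ⟨hs, h4, hω, hr⟩ := h
  refine mordellTorsionIso_of_equiv hK hc (two_torsion_trivial fun hcub => ?_)
    (nine_torsion_nine_three hc' (no_nine_division (by omega)) hs h4 hω hr) AddEquiv.uniqueProd
  exact not_isCube_four_of_hasR hK hr ((isCube_four_mul_iff hc' hcub).1 h4)

theorem torsion_of_cond66
    (hK : Module.finrank ℚ K = 3 ∨ Module.finrank ℚ K = 6) {c : ℚ} (hc : c ≠ 0) (h : Cond66 K (c : K)) :
    MordellTorsionIso K (c : K) (ZMod 6 × ZMod 6) := by
  have hc' : (c : K) ≠ 0 := by exact_mod_cast hc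
  obtain ⟨hs, hcub, h4, hω⟩ := h
  exact mordellTorsionIso_of_equiv hK hc (two_torsion_full hc' hcub hω)
    (nine_torsion_three_three hc' (no_nine_division (by omega)) hs (h4.mul hcub) hω
      fun hr => not_isCube_four_of_hasR hK hr h4)
    ((AddEquiv.prodProdProdComm _ _ _ _).trans (zmodTwoProdThree.prodCongr zmodTwoProdThree))

theorem torsion_of_cond62
    (hK : Module.finrank ℚ K = 3 ∨ Module.finrank ℚ K = 6) {c : ℚ} (hc : c ≠ 0) (h : Cond62 K (c : K)) :
    MordellTorsionIso K (c : K) (ZMod 6 × ZMod 2) := by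
  have hc' : (c : K) ≠ 0 := by exact_mod_cast hc
  obtain ⟨hs, hcub, h4, hω⟩ := h
  have h4' : ¬ IsCube (4 * (c : K)) := by rwa [isCube_four_mul_iff hc' hcub]
  exact mordellTorsionIso_of_equiv hK hc (two_torsion_full hc' hcub hω)
    (nine_torsion_three_of_isSquare hc' (no_nine_division (by omega)) hs (.inl h4')
      fun h => h4' h.1)
    (AddEquiv.prodAssoc.trans (AddEquiv.prodComm.trans
      (zmodTwoProdThree.prodCongr (AddEquiv.refl (ZMod 2)))))

theorem torsion_of_cond33
    (hK : Module.finrank ℚ K = 3 ∨ Module.finrank ℚ K = 6) {c : ℚ} (hc : c ≠ 0) (h : Cond33 K (c : K)) :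
    MordellTorsionIso K (c : K) (ZMod 3 × ZMod 3) := by
  have hc' : (c : K) ≠ 0 := by exact_mod_cast hc
  obtain ⟨hs, hcub, h4, hω, hr⟩ := h
  exact mordellTorsionIso_of_equiv hK hc (two_torsion_trivial hcub)
    (nine_torsion_three_three hc' (no_nine_division (by omega)) hs h4 hω hr) AddEquiv.uniqueProd

theorem torsion_of_cond22
    (hK : Module.finrank ℚ K = 3 ∨ Module.finrank ℚ K = 6) {c : ℚ} (hc : c ≠ 0) (h : Cond22 K (c : K)) :
    MordellTorsionIso K (c : K) (ZMod 2 × ZMod 2) := by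
  have hc' : (c : K) ≠ 0 := by exact_mod_cast hc
  obtain ⟨hcub, hs, hω⟩ := h
  exact mordellTorsionIso_of_equiv hK hc (two_torsion_full hc' hcub hω)
    (nine_torsion_trivial hc' (no_nine_division (by omega)) hs (.inl hω)) AddEquiv.prodUnique

theorem torsion_of_trivial
    (hK : Module.finrank ℚ K = 3 ∨ Module.finrank ℚ K = 6) {c : ℚ} (hc : c ≠ 0) (hcub : ¬ IsCube (c : K)) (hs : ¬ IsSquare (c : K))
    (h : HasOmega K ∨ ¬ IsCube (4 * (c : K)) ∨ ¬ IsSquare (-3 * (c : K))) :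
    MordellTorsionIso K (c : K) (ZMod 1) := by
  have hc' : (c : K) ≠ 0 := by exact_mod_cast hc
  exact mordellTorsionIso_of_equiv hK hc (two_torsion_trivial hcub)
    (nine_torsion_trivial hc' (no_nine_division (by omega)) hs h) AddEquiv.prodUnique

theorem torsion_of_not_cond
    (hK : Module.finrank ℚ K = 3 ∨ Module.finrank ℚ K = 6) {c : ℚ} (hc : c ≠ 0) (h : ¬ Cond9 K (c : K) ∧ ¬ Cond6 K (c : K) ∧ ¬ Cond3 K (c : K) ∧
    ¬ Cond2 K (c : K) ∧ ¬ Cond93 K (c : K) ∧ ¬ Cond66 K (c : K) ∧ ¬ Cond62 K (c : K) ∧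
    ¬ Cond33 K (c : K) ∧ ¬ Cond22 K (c : K)) : MordellTorsionIso K (c : K) (ZMod 1) := by
  have hc' : (c : K) ≠ 0 := by exact_mod_cast hc
  obtain ⟨h9, h6, h3, h2, h93, h66, h62, h33, h22⟩ := h
  have hs : ¬ IsSquare (c : K) := by
    intro hs
    by_cases hcub : IsCube (c : K)
    · by_cases hω : HasOmega K
      · by_cases h4 : IsCube (4 : K)
        · exact h66 ⟨hs, hcub, h4, hω⟩
        · exact h62 ⟨hs, hcub, h4, hω⟩
      · exact h6 (.inl ⟨hs, hcub, hω⟩)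
    · by_cases h4 : IsCube (4 * (c : K))
      · by_cases hω : HasOmega K <;> by_cases hr : HasR K
        · exact h93 ⟨hs, h4, hω, hr⟩
        · exact h33 ⟨hs, hcub, h4, hω, hr⟩
        · exact h9 ⟨hs, h4, hω, hr⟩
        · exact h3 (.inr (.inl ⟨hs, hcub, h4, hω, hr⟩))
      · exact h3 (.inl ⟨hs, hcub, h4⟩)
  have hcub : ¬ IsCube (c : K) := by
    intro hcub
    by_cases hω : HasOmega K
    · exact h22 ⟨hcub, hs, hω⟩
    · by_cases h4 : IsCube (4 : K)
      · by_cases hs3 : IsSquare (-3 * (c : K))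
        · exact h6 (.inr ⟨hcub, h4, hs3, hω⟩)
        · exact h2 (.inr ⟨hcub, hs, hs3, hω⟩)
      · exact h2 (.inl ⟨hcub, hs, h4, hω⟩)
  refine torsion_of_trivial hK hc hcub hs ?_
  by_contra! h
  exact h3 (.inr (.inr ⟨hcub, h.2.1, h.2.2, h.1⟩))

end Classification

/-! ### Squares and cubes in cubic and sextic fields. -/

section SquaresAndCubes

open Polynomial IntermediateField

/-- Taking norms in c = y² gives c³ = N(y)², so c is the square of N(y)/c. -/
theorem isSquare_of_finrank_eq_three {k L : Type*} [Field k] [Field L] [Algebra k L]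
    (h : Module.finrank k L = 3) {c : k} (hs : IsSquare (algebraMap k L c)) : IsSquare c := by
  obtain ⟨y, hy⟩ := hs
  by_cases hc : c = 0
  · exact ⟨0, by simp [hc]⟩
  have hN := congrArg (Algebra.norm k) hy
  rw [Algebra.norm_algebraMap, h, map_mul] at hN
  refine ⟨Algebra.norm k y / c, ?_⟩
  field_simp
  linear_combination hN

/-- A rational number that becomes a square in a sextic field containing `√d` is a square in
`ℚ(√d)`. -/
theorem isSquare_or_of_finrank_eq_six {K : Type*} [Field K] [NumberField K]
    (hK : Module.finrank ℚ K = 6) {d : ℚ} (hd : ¬ IsSquare d) {s : K} (hs : s ^ 2 = d) {b : ℚ}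
    (hb : IsSquare (b : K)) : IsSquare b ∨ ∃ v : ℚ, b = d * v ^ 2 := by
  have hirr : Irreducible (X ^ 2 - C d : ℚ[X]) := by
    rw [(monic_X_pow_sub_C d two_ne_zero).irreducible_iff_roots_eq_zero_of_degree_le_three
      (by simp) (by simp), Multiset.eq_zero_iff_forall_notMem]
    intro a ha
    have : a ^ 2 = d := by simpa [sub_eq_zero] using isRoot_of_mem_roots ha
    exact hd ⟨a, by rw [← this, sq]⟩
  have hdeg : (minpoly ℚ s).natDegree = 2 := by
    rw [← minpoly.eq_of_irreducible_of_monic hirr (by simp [hs]) (monic_X_pow_sub_C d two_ne_zero),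
      natDegree_X_pow_sub_C]
  have hint : IsIntegral ℚ s := Algebra.IsIntegral.isIntegral s
  have h2 : Module.finrank ℚ ℚ⟮s⟯ = 2 := by rw [adjoin.finrank hint, hdeg]
  have h3 : Module.finrank ℚ⟮s⟯ K = 3 := by
    have := Module.finrank_mul_finrank ℚ ℚ⟮s⟯ K
    rw [h2, hK] at this
    omega
  -- K is cubic over ℚ(√d), so b is already the square of some u + v√d; if u and v were both
  -- nonzero, √d would be rational.
  obtain ⟨z, hz⟩ := isSquare_of_finrank_eq_three h3 (c := (b : ℚ⟮s⟯)) (by simpa using hb)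
  obtain ⟨f, hf, hfz⟩ := (adjoin.powerBasis hint).exists_eq_aeval z
  rw [adjoin.powerBasis_dim, hdeg] at hf
  rw [aeval_eq_sum_range' hf] at hfz
  have hzK : (z : K) = f.coeff 0 + f.coeff 1 * s := by
    have := congrArg (algebraMap ℚ⟮s⟯ K) hfz
    simpa [Finset.sum_range_succ, adjoin.powerBasis_gen, Algebra.smul_def] using this
  have hbK : (b : K) = (z : K) * z := by simpa using congrArg (algebraMap ℚ⟮s⟯ K) hz
  generalize f.coeff 0 = u at hzK
  generalize f.coeff 1 = v at hzK
  rw [hzK] at hbK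
  have e : (b : K) = u ^ 2 + d * v ^ 2 + 2 * u * v * s := by
    rw [hbK]; linear_combination (v : K) ^ 2 * hs
  by_cases hu : u = 0
  · refine .inr ⟨v, ?_⟩
    rw [hu] at e
    have e' : (b : K) = ((d * v ^ 2 : ℚ) : K) := by push_cast; simpa using e
    exact_mod_cast e'
  by_cases hv : v = 0
  · refine .inl ⟨u, ?_⟩
    rw [hv] at e
    have e' : (b : K) = ((u * u : ℚ) : K) := by push_cast; linear_combination e
    exact_mod_cast e'
  · exfalso
    refine hd ⟨(b - u ^ 2 - d * v ^ 2) / (2 * u * v), ?_⟩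
    have hu' : (u : K) ≠ 0 := by exact_mod_cast hu
    have hv' : (v : K) ≠ 0 := by exact_mod_cast hv
    have hsq : s = (((b - u ^ 2 - d * v ^ 2) / (2 * u * v) : ℚ) : K) := by
      push_cast
      field_simp
      linear_combination -e
    rw [hsq] at hs
    have : ((b - u ^ 2 - d * v ^ 2) / (2 * u * v)) ^ 2 = d := by exact_mod_cast hs
    exact this.symm.trans (sq _)

/-- Otherwise 2 would be a cube in ℚ(t), t³ = 3. Comparing coordinates leaves only one nonzero term
in its cube root, so 2, 6 or 18 would be a rational cube. -/
theorem not_isCube_two_of_isCube_three {K : Type*} [Field K] [NumberField K]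
    (hK : ¬ 9 ∣ Module.finrank ℚ K) (h3 : IsCube (3 : K)) : ¬ IsCube (2 : K) := by
  obtain ⟨t, ht⟩ := h3
  rintro ⟨s, hs⟩
  have hdeg := minpoly_of_pow_three (n := 3) rat_pow_three_ne_three (t := t) (by simpa using ht)
  obtain ⟨z, hz⟩ := exists_root_mem_adjoin hK hdeg (p := X ^ 3 - C (2 : ℚ⟮t⟯))
    (monic_X_pow_sub_C _ three_ne_zero) natDegree_X_pow_sub_C (w := s) (by
      simp only [map_sub, map_pow, aeval_X, hs, map_ofNat, sub_self])
  have hz3 : z ^ 3 = 2 := by simpa [sub_eq_zero] using hz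
  have hzK : (z : K) ^ 3 = 2 := by
    have := congrArg (algebraMap ℚ⟮t⟯ K) hz3
    rw [map_pow, map_ofNat] at this
    exact this
  obtain ⟨a, b, c, habc⟩ := exists_quadratic_of_mem_adjoin hdeg z.2
  rw [habc] at hzK
  obtain ⟨e0, e1, e2⟩ := eq_zero_of_quadratic_eq_zero hdeg
    (a := a ^ 3 + 3 * b ^ 3 + 9 * c ^ 3 + 18 * a * b * c - 2)
    (b := 3 * (a ^ 2 * b + 3 * b ^ 2 * c + 3 * a * c ^ 2))
    (c := 3 * (a ^ 2 * c + a * b ^ 2 + 3 * b * c ^ 2)) (by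
      push_cast
      linear_combination hzK - (b ^ 3 + 6 * a * b * c + 3 * b ^ 2 * c * t + 3 * a * c ^ 2 * t +
        3 * b * c ^ 2 * t ^ 2 + c ^ 3 * (t ^ 3 + 3)) * ht)
  -- This combination eliminates all other terms. Since 3 is not a rational cube, the second factor
  -- vanishes only for b = c = 0, when a³ = 2.
  have h0 : a * (3 * c ^ 3 - b ^ 3) = 0 := by linear_combination c / 3 * e1 - b / 3 * e2
  have ha : a = 0 := by
    refine (mul_eq_zero.1 h0).resolve_right fun h => ?_
    by_cases hc : c = 0
    · subst hc
      have hb : b = 0 := by simpa using h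
      subst hb
      exact rat_pow_three_ne_two a (by linear_combination e0)
    · refine rat_pow_three_ne_three (b / c) ?_
      field_simp
      linear_combination -h
  subst ha
  have hbc : b = 0 ∨ c = 0 := by simpa using e1
  rcases hbc with rfl | rfl
  · exact rat_pow_three_ne_six (3 * c) (by linear_combination 3 * e0)
  · exact rat_pow_three_ne_eighteen (3 * b) (by linear_combination 9 * e0)

end SquaresAndCubes

/-! ### Construction of cubic and sextic fields. -/

section Fields

open Polynomial

theorem exists_cubic_field {p : ℚ[X]} (hp : Irreducible p) (h3 : p.natDegree = 3) :
    ∃ (K : Type) (_ : Field K) (_ : NumberField K), Module.finrank ℚ K = 3 ∧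
      ∃ r : K, aeval r p = 0 := by
  have := Fact.mk hp
  have : CharZero (AdjoinRoot p) := algebraRat.charZero _
  have e : (AdjoinRoot.instAlgebra p : Algebra ℚ (AdjoinRoot p)) = DivisionRing.toRatAlgebra :=
    Subsingleton.elim _ _
  have hfin : Module.Finite ℚ (AdjoinRoot p) := by
    have := (AdjoinRoot.powerBasis hp.ne_zero).finite
    rwa [e] at this
  have hrank : Module.finrank ℚ (AdjoinRoot p) = 3 := by
    have := (AdjoinRoot.powerBasis hp.ne_zero).finrank
    rwa [AdjoinRoot.powerBasis_dim, h3, e] at this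
  refine ⟨AdjoinRoot p, inferInstance, @NumberField.mk _ _ ‹_› hfin, hrank,
    AdjoinRoot.root p, ?_⟩
  rw [aeval_def]
  exact (congrArg (fun f => eval₂ f (AdjoinRoot.root p) p)
    (Subsingleton.elim _ (AdjoinRoot.of p))).trans (AdjoinRoot.eval₂_root p)

theorem exists_quadratic_extension (K : Type) [Field K] [NumberField K] {d : K}
    (hd : ¬ IsSquare d) : ∃ (L : Type) (_ : Field L) (_ : NumberField L) (f : K →+* L),
      Module.finrank ℚ L = Module.finrank ℚ K * 2 ∧ ∃ s : L, s ^ 2 = f d := by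
  have hirr : Irreducible (X ^ 2 - C d : K[X]) := by
    rw [(monic_X_pow_sub_C d two_ne_zero).irreducible_iff_roots_eq_zero_of_degree_le_three
      (by simp) (by simp), Multiset.eq_zero_iff_forall_notMem]
    intro a ha
    have : a ^ 2 = d := by simpa [sub_eq_zero] using isRoot_of_mem_roots ha
    exact hd ⟨a, by rw [← this, sq]⟩
  have := Fact.mk hirr
  have : CharZero (AdjoinRoot (X ^ 2 - C d)) := charZero_of_injective_algebraMap
    (algebraMap K (AdjoinRoot (X ^ 2 - C d))).injective
  have hfin : Module.Finite K (AdjoinRoot (X ^ 2 - C d)) :=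
    (AdjoinRoot.powerBasis hirr.ne_zero).finite
  have hrank : Module.finrank K (AdjoinRoot (X ^ 2 - C d)) = 2 := by
    rw [(AdjoinRoot.powerBasis hirr.ne_zero).finrank, AdjoinRoot.powerBasis_dim,
      natDegree_X_pow_sub_C]
  have : IsScalarTower ℚ K (AdjoinRoot (X ^ 2 - C d)) := inferInstance
  refine ⟨AdjoinRoot (X ^ 2 - C d), inferInstance, @NumberField.mk _ _ ‹_› (Module.Finite.trans K _), algebraMap K _, ?_,
    AdjoinRoot.root _, ?_⟩
  · rw [← Module.finrank_mul_finrank ℚ K, hrank]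
  · have := AdjoinRoot.mk_self (f := X ^ 2 - C d)
    rw [map_sub, map_pow, AdjoinRoot.mk_X, AdjoinRoot.mk_C, sub_eq_zero] at this
    exact this

/-- By the norm argument a rational nonsquare stays a nonsquare in a cubic field, so adjoining its
root doubles the degree. -/
theorem exists_sextic_field {p : ℚ[X]} (hp : Irreducible p) (h3 : p.natDegree = 3) {d : ℚ}
    (hd : ¬ IsSquare d) : ∃ (K : Type) (_ : Field K) (_ : NumberField K),
      Module.finrank ℚ K = 6 ∧ (∃ r : K, aeval r p = 0) ∧ ∃ s : K, s ^ 2 = (d : K) := by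
  obtain ⟨K, _, _, hK, r, hr⟩ := exists_cubic_field hp h3
  obtain ⟨L, _, _, f, hL, s, hs⟩ := exists_quadratic_extension K (d := (d : K))
    fun h => hd (isSquare_of_finrank_eq_three hK (by simpa using h))
  refine ⟨L, inferInstance, inferInstance, by rw [hL, hK], ⟨f r, ?_⟩, s, by rw [hs, map_ratCast]⟩
  have := congrArg f hr
  rw [map_zero] at this
  rw [← this, aeval_def, aeval_def, hom_eval₂]
  congr 1
  exact Subsingleton.elim _ _

end Fields

/-! ### Realizing the groups and comparing Φ(6) with Φ(3). -/

section Examples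

open Polynomial

variable {K : Type*} [Field K] [NumberField K]

/-- Powers of 2 suffice, because 2 is neither a square nor a cube in K: for instance 4 · 16 = 4³,
while 4 · 4 = 2 · 2³. -/
theorem exists_curves_of_hasR (hK : Module.finrank ℚ K = 3 ∨ Module.finrank ℚ K = 6)
    (hr : HasR K) (hω : ¬ HasOmega K) (h2 : ¬ IsSquare (2 : K)) :
    MordellTorsionIso K ((16 : ℚ) : K) (ZMod 9) ∧ MordellTorsionIso K ((1 : ℚ) : K) (ZMod 6) ∧
    MordellTorsionIso K ((4 : ℚ) : K) (ZMod 3) ∧ MordellTorsionIso K ((8 : ℚ) : K) (ZMod 2) ∧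
    MordellTorsionIso K ((32 : ℚ) : K) (ZMod 1) := by
  have n2 : ¬ IsCube (2 : K) := not_isCube_two_of_hasR (by omega) hr
  have n4 : ¬ IsCube (4 : K) := not_isCube_four_of_hasR hK hr
  have c8 : IsCube (8 : K) := ⟨2, by norm_num⟩
  have s4 : IsSquare (4 : K) := ⟨2, by norm_num⟩
  have s16 : IsSquare (16 : K) := ⟨4, by norm_num⟩
  have n8 : ¬ IsSquare (8 : K) := fun h => h2 (by
    have := h.div s4
    rwa [show (8 : K) / 4 = 2 by norm_num] at this)
  refine ⟨torsion_of_cond9 hK (by norm_num) ?_, torsion_of_cond6 hK (by norm_num) ?_,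
    torsion_of_cond3 hK (by norm_num) ?_, torsion_of_cond2 hK (by norm_num) ?_,
    torsion_of_trivial hK (by norm_num) ?_ ?_ ?_⟩
  · exact ⟨⟨4, by norm_num⟩, ⟨4, by norm_num⟩, hω, hr⟩
  · exact .inl ⟨⟨1, by norm_num⟩, ⟨1, by norm_num⟩, hω⟩
  · refine .inl ⟨⟨2, by norm_num⟩, by simpa using n4, fun h => n2 ?_⟩
    have := h.div c8
    rwa [show (4 * ((4 : ℚ) : K)) / 8 = 2 by norm_num] at this
  · exact .inl ⟨⟨2, by norm_num⟩, by simpa using n8, n4, hω⟩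
  · intro h
    have := h.div c8
    rw [show ((32 : ℚ) : K) / 8 = 4 by norm_num] at this
    exact n4 this
  · intro h
    have := h.div s16
    rw [show ((32 : ℚ) : K) / 16 = 2 by norm_num] at this
    exact h2 this
  · refine .inr (.inl fun h => n2 ?_)
    have := (h.div c8).div c8
    rwa [show 4 * ((32 : ℚ) : K) / 8 / 8 = 2 by norm_num] at this

theorem isoClass_subset_PhiMQ {G : Type} [AddCommGroup G] {d : ℕ} {K : Type} [Field K]
    [NumberField K] (hK : Module.finrank ℚ K = d) {c : ℚ} (hc : c ≠ 0)
    (h : MordellTorsionIso K (c : K) G) : isoClass G ⊆ PhiMQ d := by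
  rintro H ⟨e⟩
  obtain ⟨e'⟩ := h
  exact ⟨c, hc, K, inferInstance, inferInstance, hK, ⟨e'.trans e.symm⟩⟩

theorem hasR_of_aeval_rPoly {r : K} (h : aeval r rPoly = 0) : HasR K :=
  ⟨r, by simpa [rPoly] using h⟩

theorem small_isoClasses_subset_PhiMQ_three :
    isoClass (ZMod 9) ⊆ PhiMQ 3 ∧ isoClass (ZMod 6) ⊆ PhiMQ 3 ∧ isoClass (ZMod 3) ⊆ PhiMQ 3 ∧
    isoClass (ZMod 2) ⊆ PhiMQ 3 ∧ isoClass (ZMod 1) ⊆ PhiMQ 3 := by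
  obtain ⟨K, _, _, hK, r, hr⟩ := exists_cubic_field rPoly_irreducible rPoly_natDegree
  have sq : ∀ b : ℚ, IsSquare (b : K) → IsSquare b := fun b hb =>
    isSquare_of_finrank_eq_three hK (by simpa using hb)
  obtain ⟨h9, h6, h3, h2, h1⟩ := exists_curves_of_hasR (.inl hK) (hasR_of_aeval_rPoly hr)
    (fun h => by
      have := sq (-3) (by simpa using hasOmega_iff_isSquare.1 h)
      revert this; decide +kernel)
    (fun h => by
      have := sq 2 (by simpa using h)
      revert this; decide +kernel)
  exact ⟨isoClass_subset_PhiMQ hK (by norm_num) h9, isoClass_subset_PhiMQ hK (by norm_num) h6,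
    isoClass_subset_PhiMQ hK (by norm_num) h3, isoClass_subset_PhiMQ hK (by norm_num) h2,
    isoClass_subset_PhiMQ hK (by norm_num) h1⟩

theorem small_isoClasses_subset_PhiMQ_six :
    isoClass (ZMod 9) ⊆ PhiMQ 6 ∧ isoClass (ZMod 6) ⊆ PhiMQ 6 ∧ isoClass (ZMod 3) ⊆ PhiMQ 6 ∧
    isoClass (ZMod 2) ⊆ PhiMQ 6 ∧ isoClass (ZMod 1) ⊆ PhiMQ 6 := by
  -- The field is ℚ(r, i), in which -3 and 2 stay nonsquares because none of ±3, ±2 is a rational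
  -- square.
  have hd : ¬ IsSquare (-1 : ℚ) := by decide +kernel
  obtain ⟨K, _, _, hK, ⟨r, hr⟩, s, hs⟩ :=
    exists_sextic_field rPoly_irreducible rPoly_natDegree hd
  have sq : ∀ b : ℚ, IsSquare (b : K) → IsSquare b ∨ IsSquare (-b) := fun b hb =>
    (isSquare_or_of_finrank_eq_six hK hd hs hb).imp_right fun ⟨v, hv⟩ => ⟨v, by rw [hv]; ring⟩
  obtain ⟨h9, h6, h3, h2, h1⟩ := exists_curves_of_hasR (.inr hK) (hasR_of_aeval_rPoly hr)
    (fun h => by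
      have := sq (-3) (by simpa using hasOmega_iff_isSquare.1 h)
      revert this; decide +kernel)
    (fun h => by
      have := sq 2 (by simpa using h)
      revert this; decide +kernel)
  exact ⟨isoClass_subset_PhiMQ hK (by norm_num) h9, isoClass_subset_PhiMQ hK (by norm_num) h6,
    isoClass_subset_PhiMQ hK (by norm_num) h3, isoClass_subset_PhiMQ hK (by norm_num) h2,
    isoClass_subset_PhiMQ hK (by norm_num) h1⟩

theorem hasOmega_of_sq_eq {s : K} (hs : s ^ 2 = ((-3 : ℚ) : K)) : HasOmega K :=
  hasOmega_iff_isSquare.2 ⟨s, by rw [← sq, hs]; norm_num⟩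

/-- The fields contain √-3 and respectively r, ∛2, ∛3. The last, with c = 16, gives ℤ/3 ⊕ ℤ/3: as 3
is a cube there, 2 is not and r is absent. -/
theorem large_isoClasses_subset_PhiMQ_six :
    isoClass (ZMod 9 × ZMod 3) ⊆ PhiMQ 6 ∧ isoClass (ZMod 6 × ZMod 6) ⊆ PhiMQ 6 ∧
    isoClass (ZMod 6 × ZMod 2) ⊆ PhiMQ 6 ∧ isoClass (ZMod 3 × ZMod 3) ⊆ PhiMQ 6 ∧
    isoClass (ZMod 2 × ZMod 2) ⊆ PhiMQ 6 := by
  have hd : ¬ IsSquare (-3 : ℚ) := by decide +kernel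
  obtain ⟨K, _, _, hK, ⟨r, hr⟩, s, hs⟩ :=
    exists_sextic_field rPoly_irreducible rPoly_natDegree hd
  obtain ⟨K₂, _, _, hK₂, ⟨t, ht⟩, s₂, hs₂⟩ :=
    exists_sextic_field (X_pow_three_sub_irreducible rat_pow_three_ne_two) natDegree_X_pow_sub_C hd
  obtain ⟨K₃, _, _, hK₃, ⟨u, hu⟩, s₃, hs₃⟩ :=
    exists_sextic_field (X_pow_three_sub_irreducible rat_pow_three_ne_three) natDegree_X_pow_sub_C hd
  have hR := hasR_of_aeval_rPoly hr
  have hω := hasOmega_of_sq_eq hs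
  have h2 : IsCube (2 : K₂) := ⟨t, by simpa [sub_eq_zero] using ht⟩
  have h3 : IsCube (3 : K₃) := ⟨u, by simpa [sub_eq_zero] using hu⟩
  refine ⟨isoClass_subset_PhiMQ hK (c := 16) (by norm_num)
      (torsion_of_cond93 (.inr hK) (by norm_num) ⟨⟨4, by norm_num⟩, ⟨4, by norm_num⟩, hω, hR⟩),
    isoClass_subset_PhiMQ hK₂ (c := 1) (by norm_num)
      (torsion_of_cond66 (.inr hK₂) (by norm_num) ⟨⟨1, by norm_num⟩, ⟨1, by norm_num⟩,
        isCube_four_iff.2 h2, hasOmega_of_sq_eq hs₂⟩),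
    isoClass_subset_PhiMQ hK (c := 1) (by norm_num)
      (torsion_of_cond62 (.inr hK) (by norm_num) ⟨⟨1, by norm_num⟩, ⟨1, by norm_num⟩,
        not_isCube_four_of_hasR (.inr hK) hR, hω⟩),
    isoClass_subset_PhiMQ hK₃ (c := 16) (by norm_num)
      (torsion_of_cond33 (.inr hK₃) (by norm_num) ⟨⟨4, by norm_num⟩, fun h => ?_,
        ⟨4, by norm_num⟩, hasOmega_of_sq_eq hs₃, fun h => ?_⟩),
    isoClass_subset_PhiMQ hK (c := 8) (by norm_num)
      (torsion_of_cond22 (.inr hK) (by norm_num) ⟨⟨2, by norm_num⟩, fun h => ?_, hω⟩)⟩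
  · have h8 : IsCube (8 : K₃) := ⟨2, by norm_num⟩
    have := h.div h8
    rw [show ((16 : ℚ) : K₃) / 8 = 2 by norm_num] at this
    exact not_isCube_two_of_isCube_three (by omega) h3 this
  · exact not_isCube_three_of_hasR (by omega) h h3
  · rcases isSquare_or_of_finrank_eq_six hK hd hs h with h' | ⟨v, hv⟩
    · revert h'; decide +kernel
    · nlinarith [sq_nonneg v]

theorem PhiMQ_six_subset : PhiMQ 6 ⊆ PhiMQ 3 ∪ (isoClass (ZMod 9 × ZMod 3) ∪
    isoClass (ZMod 6 × ZMod 6) ∪ isoClass (ZMod 6 × ZMod 2) ∪ isoClass (ZMod 3 × ZMod 3) ∪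
    isoClass (ZMod 2 × ZMod 2)) := by
  rintro H ⟨c, hc, K, _, _, hK, ⟨e⟩⟩
  obtain ⟨s9, s6, s3, s2, s1⟩ := small_isoClasses_subset_PhiMQ_three
  have cls : ∀ {G : Type} [AddCommGroup G], MordellTorsionIso K (c : K) G → H ∈ isoClass G :=
    fun ⟨e'⟩ => ⟨e.symm.trans e'⟩
  have hK' : Module.finrank ℚ K = 3 ∨ Module.finrank ℚ K = 6 := .inr hK
  by_contra hH
  simp only [Set.mem_union, not_or] at hH
  obtain ⟨h3, ⟨⟨⟨h93, h66⟩, h62⟩, h33⟩, h22⟩ := hH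
  exact h3 (s1 (cls (torsion_of_not_cond hK' hc
    ⟨fun h => h3 (s9 (cls (torsion_of_cond9 hK' hc h))),
      fun h => h3 (s6 (cls (torsion_of_cond6 hK' hc h))),
      fun h => h3 (s3 (cls (torsion_of_cond3 hK' hc h))),
      fun h => h3 (s2 (cls (torsion_of_cond2 hK' hc h))),
      fun h => h93 (cls (torsion_of_cond93 hK' hc h)),
      fun h => h66 (cls (torsion_of_cond66 hK' hc h)),
      fun h => h62 (cls (torsion_of_cond62 hK' hc h)),
      fun h => h33 (cls (torsion_of_cond33 hK' hc h)),
      fun h => h22 (cls (torsion_of_cond22 hK' hc h))⟩)))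

/-- No extension of the given cubic field is used: without ω only the five cyclic groups remain, and
each occurs over ℚ(r, i). -/
theorem PhiMQ_three_subset : PhiMQ 3 ⊆ PhiMQ 6 := by
  rintro H ⟨c, hc, K, _, _, hK, ⟨e⟩⟩
  obtain ⟨s9, s6, s3, s2, s1⟩ := small_isoClasses_subset_PhiMQ_six
  have cls : ∀ {G : Type} [AddCommGroup G], MordellTorsionIso K (c : K) G → H ∈ isoClass G :=
    fun ⟨e'⟩ => ⟨e.symm.trans e'⟩
  have hK' : Module.finrank ℚ K = 3 ∨ Module.finrank ℚ K = 6 := .inl hK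
  have hω : ¬ HasOmega K := by
    intro h
    have : IsSquare (-3 : ℚ) := isSquare_of_finrank_eq_three hK
      (by simpa using hasOmega_iff_isSquare.1 h)
    revert this; decide +kernel
  by_contra hH
  exact hH (s1 (cls (torsion_of_not_cond hK' hc
    ⟨fun h => hH (s9 (cls (torsion_of_cond9 hK' hc h))),
      fun h => hH (s6 (cls (torsion_of_cond6 hK' hc h))),
      fun h => hH (s3 (cls (torsion_of_cond3 hK' hc h))),
      fun h => hH (s2 (cls (torsion_of_cond2 hK' hc h))),
      fun h => hω h.2.2.1, fun h => hω h.2.2.2, fun h => hω h.2.2.2,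
      fun h => hω h.2.2.2.1, fun h => hω h.2.2⟩)))

end Examples

theorem theorem2p3 :
    (PhiMQ 6 = PhiMQ 3 ∪ (isoClass (ZMod 9 × ZMod 3) ∪ isoClass (ZMod 6 × ZMod 6) ∪
      isoClass (ZMod 6 × ZMod 2) ∪ isoClass (ZMod 3 × ZMod 3) ∪ isoClass (ZMod 2 × ZMod 2))) ∧
    (∀ (c : ℤ), SixthPowerFree c →
      ∀ (K : Type*) [Field K] [NumberField K], Module.finrank ℚ K = 6 →
        (Cond9 K (c : K) → MordellTorsionIso K (c : K) (ZMod 9)) ∧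
        (Cond6 K (c : K) → MordellTorsionIso K (c : K) (ZMod 6)) ∧
        (Cond3 K (c : K) → MordellTorsionIso K (c : K) (ZMod 3)) ∧
        (Cond2 K (c : K) → MordellTorsionIso K (c : K) (ZMod 2)) ∧
        (Cond93 K (c : K) → MordellTorsionIso K (c : K) (ZMod 9 × ZMod 3)) ∧
        (Cond66 K (c : K) → MordellTorsionIso K (c : K) (ZMod 6 × ZMod 6)) ∧
        (Cond62 K (c : K) → MordellTorsionIso K (c : K) (ZMod 6 × ZMod 2)) ∧
        (Cond33 K (c : K) → MordellTorsionIso K (c : K) (ZMod 3 × ZMod 3)) ∧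
        (Cond22 K (c : K) → MordellTorsionIso K (c : K) (ZMod 2 × ZMod 2)) ∧
        (¬ Cond9 K (c : K) ∧ ¬ Cond6 K (c : K) ∧ ¬ Cond3 K (c : K) ∧ ¬ Cond2 K (c : K) ∧
          ¬ Cond93 K (c : K) ∧ ¬ Cond66 K (c : K) ∧ ¬ Cond62 K (c : K) ∧ ¬ Cond33 K (c : K) ∧
          ¬ Cond22 K (c : K) → MordellTorsionIso K (c : K) (ZMod 1))) := by

  refine ⟨?_, ?_⟩
  · obtain ⟨h93, h66, h62, h33, h22⟩ := large_isoClasses_subset_PhiMQ_six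
    exact PhiMQ_six_subset.antisymm (Set.union_subset PhiMQ_three_subset
      (Set.union_subset (Set.union_subset (Set.union_subset (Set.union_subset h93 h66) h62) h33)
        h22))
  · intro c hc K _ _ hK
    have hc0 : (c : ℚ) ≠ 0 := by
      rw [Int.cast_ne_zero]
      rintro rfl
      -- If c were 0, it would be divisible by 2⁶, and 2 is not a unit.
      have := hc 2 (dvd_zero _)
      rw [Int.isUnit_iff] at this
      omega
    have hK' : Module.finrank ℚ K = 3 ∨ Module.finrank ℚ K = 6 := .inr hK
    rw [← Rat.cast_intCast c]
    exact ⟨torsion_of_cond9 hK' hc0, torsion_of_cond6 hK' hc0, torsion_of_cond3 hK' hc0,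
      torsion_of_cond2 hK' hc0, torsion_of_cond93 hK' hc0, torsion_of_cond66 hK' hc0,
      torsion_of_cond62 hK' hc0, torsion_of_cond33 hK' hc0, torsion_of_cond22 hK' hc0,
      torsion_of_not_cond hK' hc0⟩
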